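/- **Setting.** Let $N,k\ge 1$ be integers, $Q=(-1/2,1/2)^N$, and let $\mathbb M^{N^l}$ be the space of real tensors of order $l$ with its Euclidean norm ($\mathbb M^{N}=\mathbb R^N$, $\mathbb M^{N^2}=\mathbb R^{N\times N}$). $\mathcal M_b(Q;V)$ is the space of bounded $V$-valued Radon measures on $Q$, and $|\mu|_{\mathcal M_b}$ is the total variation of $\mu$ (equal to $+\infty$ for a distribution that is not a bounded measure). A first order operator $\mathscr B:\mathcal D'(Q;\mathbb M^{N^l})\to\mathcal D'(Q;\mathbb M^{N^{l+1}})$ is $\mathscr Bv=\sum_{i=1}^N B^i\,\partial_{x_i}v$, where each $B^i$ is a real tensor of order $2l+1$, acting as a linear map $\mathbb M^{N^l}\to\mathbb M^{N^{l+1}}$; put $\|\mathscr B\|_{\ell^\infty}=\sum_i\|B^i\|$ (Euclidean norms), and identify operators with their coefficients. Let $BV_{\mathscr B}=\{v\in L^1(Q;\mathbb M^{N^l}):\mathscr Bv\in\mathcal M_b(Q;\mathbb M^{N^{l+1}})\}$, with $\|v\|_{BV_{\mathscr B}}=\|v\|_{L^1}+|\mathscr Bv|_{\mathcal M_b}$.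 Call $\mathscr B$ *admissible* if (1) $BV_{\mathscr B}$ is a Banach space; (2) for every $v\in BV_{\mathscr B}$ there are $v_n\in C^\infty(\overline Q;\mathbb M^{N^l})$ with $v_n\to v$ in $L^1$ and $|\mathscr Bv_n|_{\mathcal M_b}\to|\mathscr Bv|_{\mathcal M_b}$; (3) the injection $BV_{\mathscr B}\hookrightarrow L^1(Q;\mathbb M^{N^l})$ is compact. Let $\Pi_l$ be the set of admissible $\mathscr B$ whose null-space $\{v\in L^1(Q;\mathbb M^{N^l}):\mathscr Bv=0\}$ is finite dimensional, and $\Pi^k=\Pi_1\times\cdots\times\Pi_k$. A set $S$ of operators of one order $l$ has the *compactness and closure property* if, whenever $\mathscr B_n\in S$ are admissible and $\sup_n(\|\mathscr B_n\|_{\ell^\infty}+\|v_n\|_{BV_{\mathscr B_n}})<\infty$, there are an operator $\mathscr B$ and $v\in BV_{\mathscr B}$ such that, along a subsequence, $v_n\to v$ in $L^1$ and $\mathscr B_nv_n\rightharpoonup\mathscr Bv$ weakly$^*$ in $\mathcal M_b$. A *training set* is a set $\Sigma\subset\Pi^k$ that is closed and bounded in $\ell^\infty$ (in the finite-dimensional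 space of all $k$-tuples of operators) and whose projection to each of the $k$ components has the compactness and closure property. For $\alpha=(\alpha_0,\dots,\alpha_k)\in(0,\infty)^{k+1}$, $\mathscr B[k]=(\mathscr B^0,\dots,\mathscr B^{k-1})\in\Pi^k$ and $u\in L^1(Q)$ let $$PGV^{k+1}_{\alpha,\mathscr B[k]}(u)=\inf\Big\{\alpha_0|Du-v_0|_{\mathcal M_b}+\sum_{l=1}^{k-1}\alpha_l|v_l-\mathscr B^{l-1}v_{l-1}|_{\mathcal M_b}+\alpha_k|\mathscr B^{k-1}v_{k-1}|_{\mathcal M_b}:\ v_l\in BV_{\mathscr B^l}(Q;\mathbb M^{N^{l+1}}),\ 0\le l\le k-1\Big\}.$$ **Theorem 5.2.** Let $u_\eta\in L^2(Q)$, $u_c\in BV(Q)$ and $\theta\in(0,1)$, and let $\Sigma\subset\Pi^k$ be a non-empty training set. For all $\alpha\in[\theta,1/\theta]^{k+1}$ and $\mathscr B[k]\in\Sigma$ the Level 2 problem $$\min\big\{\|u-u_\eta\|_{L^2(Q)}^2+PGV^{k+1}_{\alpha,\mathscr B[k]}(u):\ u\in BV(Q)\big\}$$ has exactly one minimizer $u_{\alpha,\mathscr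 B[k]}$, and the training scheme $(\mathcal T^{k+1}_\theta)$ has a solution: there is $(\tilde\alpha,\tilde{\mathscr B}[k])\in[\theta,1/\theta]^{k+1}\times\Sigma$ with $$\|u_c-u_{\tilde\alpha,\tilde{\mathscr B}[k]}\|_{L^2(Q)}^2\le\|u_c-u_{\alpha,\mathscr B[k]}\|_{L^2(Q)}^2\qquad\text{for all }(\alpha,\mathscr B[k])\in[\theta,1/\theta]^{k+1}\times\Sigma,$$ and the optimal reconstruction satisfies $u_{\tilde\alpha,\tilde{\mathscr B}[k]}\in BV(Q)$. (Here $\|\cdot\|_{L^2(Q)}=+\infty$ for functions that are not in $L^2(Q)$.) -/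

import Mathlib

open MeasureTheory Filter Topology TopologicalSpace
open scoped ENNReal NNReal Distributions LineDeriv ZeroAtInfty

namespace PGV

noncomputable section

/-- The space `ℝ^N` with its Euclidean norm. -/
abbrev Rn (N : ℕ) : Type := EuclideanSpace ℝ (Fin N)

/-- The space `𝕄^{N^l}` of real tensors of order `l`, with its Euclidean norm; a tensor has one
entry for every multi-index in `{1, …, N}^l`. -/
abbrev Tensor (N l : ℕ) : Type := EuclideanSpace ℝ (Fin l → Fin N)

/-- The open unit cube `Q = (-1/2, 1/2)^N`. -/
def cube (N : ℕ) : Opens (Rn N) where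
  carrier := {x | ∀ i, x i ∈ Set.Ioo (-1 / 2 : ℝ) (1 / 2)}
  is_open' := by
    have h : {x : Rn N | ∀ i, x i ∈ Set.Ioo (-1 / 2 : ℝ) (1 / 2)} =
        ⋂ i, (fun x : Rn N => x i) ⁻¹' Set.Ioo (-1 / 2 : ℝ) (1 / 2) := by
      ext x; simp
    rw [h]
    exact isOpen_iInter_of_finite fun i => isOpen_Ioo.preimage (by fun_prop)

/-- Lebesgue measure on `Q`. -/
abbrev leb (N : ℕ) : Measure (Rn N) := volume.restrict (cube N : Set (Rn N))

/-- The Banach space `L¹(Q; V)`. -/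
abbrev L1 (N : ℕ) (V : Type) [NormedAddCommGroup V] : Type := Lp V 1 (leb N)

/-! ### Distributions and bounded Radon measures on `Q` -/

section Distributions

variable {N : ℕ} {V : Type} [NormedAddCommGroup V] [NormedSpace ℝ V]

/-- The distribution `φ ↦ ∫_Q φ v dx` given by a function `v ∈ L¹(Q; V)`. -/
def ofFun (v : L1 N V) : 𝓓'(cube N, V) :=
  (TestFunction.integralAgainstBilinCLM (ContinuousLinearMap.lsmul ℝ ℝ) (leb N) v :
    𝓓(cube N, ℝ) →L[ℝ] V)

lemma integrable_ofFun (v : L1 N V) (φ : 𝓓(cube N, ℝ)) :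
    Integrable (fun x => φ x • v x) (leb N) :=
  TestFunction.integrable_bilin (ContinuousLinearMap.lsmul ℝ ℝ)
    ((L1.integrable_coeFn v).locallyIntegrable.locallyIntegrableOn _) φ

lemma ofFun_apply (v : L1 N V) (φ : 𝓓(cube N, ℝ)) :
    ofFun v φ = ∫ x, φ x • v x ∂(leb N) :=
  TestFunction.integralAgainstBilinCLM_eq_integral
    ((L1.integrable_coeFn v).locallyIntegrable.locallyIntegrableOn _)

/-- The map `v ↦ ofFun v` as a linear map. -/
def toDistr : L1 N V →ₗ[ℝ] 𝓓'(cube N, V) where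
  toFun := ofFun
  map_add' v w := by
    ext φ
    change ofFun (v + w) φ = ofFun v φ + ofFun w φ
    rw [ofFun_apply, ofFun_apply, ofFun_apply,
      ← integral_add (integrable_ofFun v φ) (integrable_ofFun w φ)]
    apply integral_congr_ae
    filter_upwards [Lp.coeFn_add v w] with x hx
    rw [hx, Pi.add_apply, smul_add]
  map_smul' c v := by
    ext φ
    change ofFun (c • v) φ = c • ofFun v φ
    rw [ofFun_apply, ofFun_apply, ← integral_smul]
    apply integral_congr_ae
    filter_upwards [Lp.coeFn_smul c v] with x hx
    simp [hx, smul_comm c]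

/-- The integral `∫_Q f dμ ∈ V` of a real function `f` against a `V`-valued measure `μ` on `Q`. -/
def integ (μ : VectorMeasure (cube N) V) (f : cube N → ℝ) : V :=
  μ.integral f (ContinuousLinearMap.lsmul ℝ ℝ)

/-- The distribution `T` on `Q` is the measure `μ ∈ M_b(Q; V)`. (For a finite-dimensional `V`,
every countably additive `V`-valued Borel measure on `Q` is a bounded Radon measure.) -/
def IsMeas (T : 𝓓'(cube N, V)) (μ : VectorMeasure (cube N) V) : Prop :=
  ∀ φ : 𝓓(cube N, ℝ), T φ = integ μ fun x => φ (x : Rn N)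

/-- The total variation `|T|_{M_b(Q; V)}`: the total mass of `|μ|` if `T` is the measure `μ`, and
`+∞` if `T` is not a measure. -/
def mass (T : 𝓓'(cube N, V)) : ℝ≥0∞ :=
  ⨅ (μ : VectorMeasure (cube N) V) (_ : IsMeas T μ), μ.variation Set.univ

/-- The distributions `T n` and `T'` are bounded Radon measures on `Q`, and `T n` converges to `T'`
weakly* in `M_b(Q; V)`, that is, against every function in `C₀(Q)`. -/
def WeakStarTendsto (T : ℕ → 𝓓'(cube N, V)) (T' : 𝓓'(cube N, V)) : Prop :=
  ∃ (μ : ℕ → VectorMeasure (cube N) V) (μ' : VectorMeasure (cube N) V),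
    (∀ n, IsMeas (T n) (μ n)) ∧ IsMeas T' μ' ∧
      ∀ ψ : C₀(cube N, ℝ), Tendsto (fun n => integ (μ n) ψ) atTop (𝓝 (integ μ' ψ))

end Distributions

/-! ### First order operators -/

/-- The coefficients `(B^1, …, B^N)` of a first order operator `ℬ` which maps distributions with
values in `𝕄^{N^l}` to distributions with values in `𝕄^{N^{l+1}}`. The coefficient `B^i` is a real
tensor whose entries are indexed by the pairs (index of an output entry, index of an input entry).
The norm of this space is `‖ℬ‖_{ℓ^∞} = ∑ i, ‖B^i‖`, with `‖B^i‖` the Euclidean norm. -/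
abbrev Op (N l : ℕ) : Type :=
  PiLp 1 fun _ : Fin N => EuclideanSpace ℝ ((Fin (l + 1) → Fin N) × (Fin l → Fin N))

/-- The linear map `𝕄^{N^l} → 𝕄^{N^{l+1}}`, `(C w)_I = ∑ J, C_{I J} w_J`. -/
def contract {N l : ℕ} (C : EuclideanSpace ℝ ((Fin (l + 1) → Fin N) × (Fin l → Fin N))) :
    Tensor N l →L[ℝ] Tensor N (l + 1) :=
  LinearMap.toContinuousLinearMap
    { toFun := fun w => WithLp.toLp 2 fun I => ∑ J, C (I, J) * w J
      map_add' := fun w z => by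
        ext I; simp [mul_add, Finset.sum_add_distrib]
      map_smul' := fun c w => by
        ext I; simp [Finset.mul_sum, mul_left_comm] }

/-- The distribution `ℬ v = ∑ i, B^i ∂_i v` on `Q`, for `v ∈ L¹(Q; 𝕄^{N^l})`. -/
def diffOp {N l : ℕ} (B : Op N l) : L1 N (Tensor N l) →ₗ[ℝ] 𝓓'(cube N, Tensor N (l + 1)) where
  toFun v := ∑ i : Fin N, Distribution.mapCLM (contract (B i))
    (∂_{EuclideanSpace.single i (1 : ℝ)} (toDistr v))
  map_add' v w := by
    simp [map_add, LineDeriv.lineDerivOp_add, Finset.sum_add_distrib]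
  map_smul' c v := by
    simp [map_smul, LineDeriv.lineDerivOp_smul, Finset.smul_sum]

/-- The distributional gradient `Du = (∂_1 u, …, ∂_N u)` on `Q` of `u ∈ L¹(Q)`. -/
def grad {N : ℕ} (u : L1 N ℝ) : 𝓓'(cube N, Tensor N 1) :=
  ∑ i : Fin N, Distribution.mapCLM
    (ContinuousLinearMap.toSpanSingleton ℝ (EuclideanSpace.single (fun _ : Fin 1 => i) (1 : ℝ)))
    (∂_{EuclideanSpace.single i (1 : ℝ)} (toDistr u))

/-- The space `BV(Q)`. -/
def BV (N : ℕ) : Set (L1 N ℝ) := {u | ∃ μ, IsMeas (grad u) μ}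

/-- The space `BV_ℬ(Q; 𝕄^{N^l})`. -/
def BVB {N l : ℕ} (B : Op N l) : Set (L1 N (Tensor N l)) := {v | ∃ μ, IsMeas (diffOp B v) μ}

/-- The norm `‖v‖_{L¹} + |ℬ v|_{M_b}` of `BV_ℬ(Q; 𝕄^{N^l})`. -/
def bvbNorm {N l : ℕ} (B : Op N l) (v : L1 N (Tensor N l)) : ℝ≥0∞ := ‖v‖ₑ + mass (diffOp B v)

/-- The assumption on a single operator: `BV_ℬ` is complete, `C^∞(Q̄)` is strictly dense in it, and
its injection into `L¹` is compact. A function in `C^∞(Q̄)` is the restriction to `Q` of a smooth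
function on `ℝ^N`. -/
structure IsAdmissible {N l : ℕ} (B : Op N l) : Prop where
  complete : ∀ v : ℕ → L1 N (Tensor N l), (∀ n, v n ∈ BVB B) →
    (∀ ε : ℝ≥0∞, 0 < ε → ∃ n₀, ∀ m ≥ n₀, ∀ n ≥ n₀, bvbNorm B (v m - v n) < ε) →
    ∃ w ∈ BVB B, Tendsto (fun n => bvbNorm B (v n - w)) atTop (𝓝 0)
  dense : ∀ v ∈ BVB B, ∃ (f : ℕ → Rn N → Tensor N l) (w : ℕ → L1 N (Tensor N l)),
    (∀ n, ContDiff ℝ (⊤ : ℕ∞) (f n)) ∧ (∀ n, w n =ᵐ[leb N] f n) ∧ (∀ n, w n ∈ BVB B) ∧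
    Tendsto w atTop (𝓝 v) ∧
    Tendsto (fun n => mass (diffOp B (w n))) atTop (𝓝 (mass (diffOp B v)))
  compact : ∀ C : ℝ≥0, IsCompact (closure {v : L1 N (Tensor N l) | v ∈ BVB B ∧ bvbNorm B v ≤ C})

/-- The class `Π_l`. -/
def classPi (N l : ℕ) : Set (Op N l) :=
  {B | FiniteDimensional ℝ (LinearMap.ker (diffOp B)) ∧ IsAdmissible B}

/-- The compactness and closure assumption, for the operators in a set `S`. -/
def CompactClosure {N l : ℕ} (S : Set (Op N l)) : Prop :=
  ∀ (v : ℕ → L1 N (Tensor N l)) (B : ℕ → Op N l), (∀ n, B n ∈ S ∧ IsAdmissible (B n)) →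
    (⨆ n, (‖B n‖ₑ + bvbNorm (B n) (v n))) < ∞ →
    ∃ (B' : Op N l) (v' : L1 N (Tensor N l)) (j : ℕ → ℕ), v' ∈ BVB B' ∧ StrictMono j ∧
      Tendsto (fun n => v (j n)) atTop (𝓝 v') ∧
      WeakStarTendsto (fun n => diffOp (B (j n)) (v (j n))) (diffOp B' v')

/-! ### The seminorms, training sets and the training scheme -/

/-- A tuple `ℬ[k] = (ℬ^0, …, ℬ^{k-1})`, where `ℬ^l` maps tensors of order `l + 1` to tensors of
order `l + 2`. -/
abbrev OpTuple (N k : ℕ) : Type := (l : Fin k) → Op N (l + 1)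

/-- The auxiliary functions `v = (v_0, …, v_{k-1})` with `v_l ∈ BV_{ℬ^l}(Q; 𝕄^{N^{l+1}})`. The tuple
is continued by `v_l = 0` for `l ≥ k`. -/
def competitors {N k : ℕ} (B : OpTuple N k) : Set ((l : ℕ) → L1 N (Tensor N (l + 1))) :=
  {v | (∀ l : Fin k, v l ∈ BVB (B l)) ∧ ∀ l, k ≤ l → v l = 0}

/-- The seminorm `PGV^{k+1}_{α, ℬ[k]}(u)`, the infimum over all `v` of
`α_0 |Du - v_0| + ∑_{l=1}^{k-1} α_l |v_l - ℬ^{l-1} v_{l-1}| + α_k |ℬ^{k-1} v_{k-1}|`.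
The last term is the term `l = k` of the sum, since `v_k = 0`. -/
def pgv {N k : ℕ} (α : Fin (k + 1) → ℝ) (B : OpTuple N k) (u : L1 N ℝ) : ℝ≥0∞ :=
  ⨅ v ∈ competitors B,
    ENNReal.ofReal (α 0) * mass (grad u - toDistr (v 0)) +
      ∑ l : Fin k, ENNReal.ofReal (α l.succ) * mass (toDistr (v (l + 1)) - diffOp (B l) (v l))

/-- `Σ ⊂ Π_1 × ⋯ × Π_k` is a training set. -/
structure IsTrainingSet {N k : ℕ} (S : Set (OpTuple N k)) : Prop where
  subset_classPi : ∀ B ∈ S, ∀ l : Fin k, B l ∈ classPi N (l + 1)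
  compactClosure : ∀ l : Fin k, CompactClosure ((fun B : OpTuple N k => B l) '' S)
  isClosed : IsClosed S
  isBounded : Bornology.IsBounded S

/-- The squared distance `‖u - w‖²_{L²(Q)}`, with value `+∞` if `u - w` is not in `L²(Q)`. -/
def sqDist {N : ℕ} (u w : Rn N → ℝ) : ℝ≥0∞ := eLpNorm (fun x => u x - w x) 2 (leb N) ^ 2

/-- `u` is a solution of the Level 2 problem: it minimizes
`‖u - u_η‖²_{L²(Q)} + PGV^{k+1}_{α, ℬ[k]}(u)` over `u ∈ BV(Q)`. -/
def IsReconstruction {N k : ℕ} (uη : Rn N → ℝ) (α : Fin (k + 1) → ℝ) (B : OpTuple N k)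
    (u : L1 N ℝ) : Prop :=
  u ∈ BV N ∧ ∀ w ∈ BV N, sqDist u uη + pgv α B u ≤ sqDist w uη + pgv α B w

/-- The parameters `(α, ℬ[k]) ∈ [θ, 1/θ]^{k+1} × Σ`. -/
def params {N k : ℕ} (θ : ℝ) (S : Set (OpTuple N k)) : Set ((Fin (k + 1) → ℝ) × OpTuple N k) :=
  {p | (∀ i, p.1 i ∈ Set.Icc θ (1 / θ)) ∧ p.2 ∈ S}

end

end PGV

namespace PGV

noncomputable section

/-! ### Vector measures with a density -/

section VectorMeasure

variable {X : Type*} [MeasurableSpace X]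

/-! The proof is the direct method, applied first to the Level 2 problem and then to the parameters;
it needs a lower and an upper semicontinuity property of `pgv`. The common tool is
`mass_eq_dualMass`: the total variation of a distribution is the supremum of its pairings with
vectors of test functions of pointwise Euclidean norm at most one. Hence it is lower semicontinuous
under convergence of distributions, and membership in `BV` or `BVB` just means that it is finite.

Lower semicontinuity, jointly in parameters and function (`pgv_le_of_tendsto`): nearly optimal
auxiliary functions have bounded defects. They are bounded in L¹ (`exists_enorm_le`); otherwise,
divided by their total norm, they would converge along a subsequence, by the compactness property,
to a tuple all of whose defects vanish for `u = 0`. Then v_0 = D0 = 0, v_1 = ℬ^0 v_0 = 0 and so on,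
although the total norm is one. So the auxiliary functions converge in L¹ along a subsequence, ℬ_n
v_n converges as a distribution, and the defects pass to the limit.

Upper semicontinuity in the parameters, for a fixed function (`eventually_pgv_lt`): a competitor for
ℬ need not be one for a nearby operator. It is replaced by x ↦ (ρ ⋆ v)(t x), with t < 1 and a
mollifier ρ of scale 1 - t. For fixed t, every first order operator sends this function to a measure
of mass at most K_t ‖ℬ‖ ‖v‖, so changing the operator costs little; the defects for ℬ itself grow
only by amounts that vanish as t → 1. The dilation makes the adjoint operation preserve the test
functions on the cube, so zero extension creates no boundary term.

Weak compactness in L² and lower semicontinuity give a minimizer, and the parallelogram law makes it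
unique. If parameters converge, both semicontinuities identify a weak limit of reconstructions as
the reconstruction of the limit, and the distance to u_c is weakly lower semicontinuous. The
parameter set is compact, so a minimizing sequence of parameters yields an optimum. If u_c is not in
L², all distances are infinite and any parameter is optimal. -/

lemma enorm_integral_smul_le {E : Type*} [NormedAddCommGroup E] [NormedSpace ℝ E]
    {m : Measure X} {h : X → E} (hh : Integrable h m) {f : X → ℝ}
    (hf : Integrable f (m.withDensity fun x => ‖h x‖ₑ)) :
    ‖∫ x, f x • h x ∂m‖ₑ ≤ ∫⁻ x, ‖f x‖ₑ ∂(m.withDensity fun x => ‖h x‖ₑ) := by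
  refine (enorm_integral_le_lintegral_enorm _).trans ?_
  rw [lintegral_withDensity_eq_lintegral_mul₀' hh.1.enorm hf.1.enorm]
  simp [enorm_smul, mul_comm]

lemma integrable_smul_of_withDensity {E : Type*} [NormedAddCommGroup E] [NormedSpace ℝ E]
    {m : Measure X} {h : X → E} (hh : Integrable h m) {f : X → ℝ}
    (hf : Integrable f (m.withDensity fun x => ‖h x‖ₑ)) :
    Integrable (fun x => f x • h x) m := by
  have h1 : Integrable (fun x => ‖h x‖ • f x) m := by
    have := (integrable_withDensity_iff_integrable_smul₀' (μ := m) (f := fun x => ‖h x‖ₑ)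
      hh.1.enorm (by simp) (g := f)).1 hf
    simpa using this
  -- `f` is controlled only for the weighted measure, so it may fail to be measurable where `h = 0`.
  -- The product is measurable because it factors as `‖h‖ f` times the direction `h / ‖h‖`.
  have hsm : AEStronglyMeasurable (fun x => f x • h x) m := by
    have : (fun x => f x • h x) = fun x => (‖h x‖ • f x) • (‖h x‖⁻¹ • h x) := by
      ext x
      by_cases hx : h x = 0
      · simp [hx]
      · have : ‖h x‖ ≠ 0 := by simpa using hx
        rw [smul_smul, smul_eq_mul]
        congr 1
        field_simp
    rw [this]
    exact h1.1.smul (hh.1.norm.inv₀.smul hh.1)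
  exact h1.mono hsm (by filter_upwards with x; simp [norm_smul, mul_comm])

/-- The integral with respect to a vector measure with a density. -/
lemma integral_withDensityᵥ {E : Type*} [NormedAddCommGroup E] [NormedSpace ℝ E] [CompleteSpace E]
    {m : Measure X} {h : X → E} (hh : Integrable h m) {f : X → ℝ}
    (hf : Integrable f (m.withDensity fun x => ‖h x‖ₑ)) :
    (m.withDensityᵥ h).integral f (ContinuousLinearMap.lsmul ℝ ℝ) = ∫ x, f x • h x ∂m := by
  have hvar := Measure.variation_withDensityᵥ hh
  have hfin : IsFiniteMeasure (m.withDensityᵥ h).variation := by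
    rw [hvar]; exact ⟨by simpa using! hh.2⟩
  rw [← hvar] at hf
  refine Integrable.induction (P := fun f => (m.withDensityᵥ h).integral f
    (ContinuousLinearMap.lsmul ℝ ℝ) = ∫ x, f x • h x ∂m) ?_ ?_ ?_ ?_ hf
  · intro c s hs hsf
    rw [VectorMeasure.integral_indicator_const _ hs, withDensityᵥ_apply hh hs]
    simp only [ContinuousLinearMap.lsmul_apply]
    rw [← integral_smul, ← integral_indicator hs]
    congr 1 with x
    by_cases hx : x ∈ s <;> simp [hx]
  · intro f g _ hf hg hf' hg'
    rw [VectorMeasure.integral_add hf hg, hf', hg']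
    rw [hvar] at hf hg
    rw [← integral_add (integrable_smul_of_withDensity hh hf)
      (integrable_smul_of_withDensity hh hg)]
    simp [add_smul]
  -- Both sides are continuous on L¹ of the variation; the right side is even 1-Lipschitz, since the
  -- variation has density `‖h‖`.
  · refine isClosed_eq VectorMeasure.continuous_integral ?_
    refine LipschitzWith.continuous (K := 1) fun f g => ?_
    have key : ∀ F : X → ℝ, Integrable F (m.withDensityᵥ h).variation →
        Integrable F (m.withDensity fun x => ‖h x‖ₑ) := fun F hF => hvar ▸ hF
    have hf := key _ (L1.integrable_coeFn f)
    have hg := key _ (L1.integrable_coeFn g)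
    have hfg := hf.sub hg
    rw [edist_eq_enorm_sub, ← integral_sub (integrable_smul_of_withDensity hh hf)
      (integrable_smul_of_withDensity hh hg)]
    simp_rw [← sub_smul]
    refine (enorm_integral_smul_le hh hfg).trans ?_
    rw [← hvar, ENNReal.coe_one, one_mul, MeasureTheory.L1.edist_def]
    simp [edist_eq_enorm_sub]
  · intro f g hfg hf hf'
    rw [← VectorMeasure.integral_congr_ae hfg, hf']
    refine integral_congr_ae ?_
    rw [hvar, Filter.EventuallyEq, ae_withDensity_iff' hh.1.enorm] at hfg
    filter_upwards [hfg] with x hx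
    by_cases h0 : h x = 0
    · simp [h0]
    · rw [hx (by simpa using h0)]

variable {ι : Type*} [Fintype ι]

/-- The coordinates of a measure with values in a Euclidean space. -/
def coordMeasure (μ : VectorMeasure X (EuclideanSpace ℝ ι)) (i : ι) : SignedMeasure X :=
  μ.mapRange (EuclideanSpace.proj (𝕜 := ℝ) i).toLinearMap.toAddMonoidHom
    (EuclideanSpace.proj (𝕜 := ℝ) i).continuous

omit [Fintype ι] in
lemma coordMeasure_apply (μ : VectorMeasure X (EuclideanSpace ℝ ι)) (i : ι) (s : Set X) :
    coordMeasure μ i s = μ s i := rfl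

/-- A measure with values in a Euclidean space has a density with respect to a finite measure. -/
lemma exists_eq_withDensityᵥ (μ : VectorMeasure X (EuclideanSpace ℝ ι)) :
    ∃ (m : Measure X) (h : X → EuclideanSpace ℝ ι), IsFiniteMeasure m ∧ Integrable h m ∧
      μ = m.withDensityᵥ h := by
  classical
  -- This finite measure dominates every coordinate, so Radon–Nikodym applies coordinatewise.
  let m : Measure X := ∑ i, (coordMeasure μ i).totalVariation
  have hm : IsFiniteMeasure m := inferInstance
  have hac : ∀ i, coordMeasure μ i ≪ᵥ m.toENNRealVectorMeasure := by
    intro i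
    rw [SignedMeasure.absolutelyContinuous_ennreal_iff,
      show m.toENNRealVectorMeasure.ennrealToMeasure = m from
        VectorMeasure.equivMeasure.right_inv m]
    refine Measure.AbsolutelyContinuous.mk fun s _ hs => ?_
    simp only [m, Measure.finsetSum_apply] at hs
    exact (Finset.sum_eq_zero_iff.1 hs) i (Finset.mem_univ i)
  let h : X → EuclideanSpace ℝ ι := fun x =>
    WithLp.toLp 2 fun i => (coordMeasure μ i).rnDeriv m x
  have hh : Integrable h m := by
    have : h = fun x => ∑ i, (coordMeasure μ i).rnDeriv m x • EuclideanSpace.single i (1 : ℝ) := by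
      ext x i
      simp [h, Finset.sum_apply, Pi.single_apply]
    rw [this]
    exact integrable_finsetSum _ fun i _ => (SignedMeasure.integrable_rnDeriv _ _).smul_const _
  refine ⟨m, h, hm, hh, ?_⟩
  ext s hs i
  rw [← coordMeasure_apply, withDensityᵥ_apply hh hs,
    ← ((SignedMeasure.absolutelyContinuous_iff_withDensityᵥ_rnDeriv_eq _ _).1 (hac i)),
    withDensityᵥ_apply (SignedMeasure.integrable_rnDeriv _ _) hs]
  exact (EuclideanSpace.proj (𝕜 := ℝ) i).integral_comp_comm hh.integrableOn

end VectorMeasure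

/-! ### Riesz representation of bounded linear functionals -/

section Riesz

open CompactlySupported CompactlySupportedContinuousMap

variable {X : Type*} [TopologicalSpace X]

/-- The values of a linear functional on the order interval `[0, f]`. -/
def intervalValues (L : C_c(X, ℝ) →ₗ[ℝ] ℝ) (f : C_c(X, ℝ)) : Set ℝ :=
  L '' Set.Icc 0 f

/-- The positive part of a linear functional, on nonnegative functions. -/
def posValue (L : C_c(X, ℝ) →ₗ[ℝ] ℝ) (f : C_c(X, ℝ)) : ℝ := sSup (intervalValues L f)

/-- Boundedness of a linear functional with respect to the supremum norm. -/
def IsSupBounded (L : C_c(X, ℝ) →ₗ[ℝ] ℝ) (C : ℝ) : Prop :=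
  ∀ (f : C_c(X, ℝ)) (M : ℝ), 0 ≤ M → (∀ x, |f x| ≤ M) → L f ≤ C * M

variable {L : C_c(X, ℝ) →ₗ[ℝ] ℝ} {C : ℝ}

lemma exists_bound (f : C_c(X, ℝ)) : ∃ M, 0 ≤ M ∧ ∀ x, |f x| ≤ M := by
  obtain ⟨M, hM⟩ := f.hasCompactSupport.exists_bound_of_continuous f.continuous
  exact ⟨max M 0, le_max_right _ _, fun x => (hM x).trans (le_max_left _ _)⟩

lemma IsSupBounded.le_of_mem (hL : IsSupBounded L C) {f : C_c(X, ℝ)} {M : ℝ} (hM : 0 ≤ M)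
    (hf : ∀ x, f x ≤ M) {r : ℝ} (hr : r ∈ intervalValues L f) : r ≤ C * M := by
  obtain ⟨g, ⟨hg0, hg⟩, rfl⟩ := hr
  refine hL g M hM fun x => ?_
  rw [abs_of_nonneg (hg0 x)]
  exact (hg x).trans (hf x)

lemma IsSupBounded.bddAbove (hL : IsSupBounded L C) (f : C_c(X, ℝ)) :
    BddAbove (intervalValues L f) := by
  obtain ⟨M, hM, hf⟩ := exists_bound f
  exact ⟨C * M, fun r hr => hL.le_of_mem hM (fun x => (le_abs_self _).trans (hf x)) hr⟩

lemma zero_mem_intervalValues {f : C_c(X, ℝ)} (hf : 0 ≤ f) : (0 : ℝ) ∈ intervalValues L f :=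
  ⟨0, ⟨le_rfl, hf⟩, map_zero L⟩

lemma IsSupBounded.posValue_nonneg (hL : IsSupBounded L C) {f : C_c(X, ℝ)} (hf : 0 ≤ f) :
    0 ≤ posValue L f :=
  le_csSup (hL.bddAbove f) (zero_mem_intervalValues hf)

lemma IsSupBounded.le_posValue (hL : IsSupBounded L C) {f : C_c(X, ℝ)} (hf : 0 ≤ f) :
    L f ≤ posValue L f :=
  le_csSup (hL.bddAbove f) ⟨f, ⟨hf, le_rfl⟩, rfl⟩

lemma IsSupBounded.posValue_le (hL : IsSupBounded L C) {f : C_c(X, ℝ)} (hf : 0 ≤ f) {M : ℝ}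
    (hM : 0 ≤ M) (h : ∀ x, f x ≤ M) : posValue L f ≤ C * M :=
  csSup_le ⟨0, zero_mem_intervalValues hf⟩ fun _ hr => hL.le_of_mem hM h hr

/-- Riesz decomposition: any `h` between `0` and `f + g` splits as `h ⊓ f` in `[0, f]` plus a
remainder in `[0, g]`. -/
lemma IsSupBounded.posValue_add (hL : IsSupBounded L C) {f g : C_c(X, ℝ)} (hf : 0 ≤ f)
    (hg : 0 ≤ g) : posValue L (f + g) = posValue L f + posValue L g := by
  apply le_antisymm
  · refine csSup_le ⟨0, zero_mem_intervalValues (add_nonneg hf hg)⟩ ?_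
    rintro _ ⟨h, ⟨h0, h1⟩, rfl⟩
    have e : h = h ⊓ f + (h - h ⊓ f) := by abel
    rw [e, map_add]
    refine add_le_add (le_csSup (hL.bddAbove f) ⟨_, ⟨le_inf h0 hf, inf_le_right⟩, rfl⟩)
      (le_csSup (hL.bddAbove g) ⟨_, ⟨?_, ?_⟩, rfl⟩)
    · intro x
      simp
    · intro x
      have := h1 x
      have h2 := h0 x
      have h3 := hg x
      simp only [CompactlySupportedContinuousMap.coe_add, Pi.add_apply,
        CompactlySupportedContinuousMap.coe_zero, Pi.zero_apply] at this h2 h3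
      simp only [CompactlySupportedContinuousMap.coe_sub, Pi.sub_apply, inf_apply]
      rcases le_total (h x) (f x) with h4 | h4 <;> simp [h4] <;> linarith
  · rw [← le_sub_iff_add_le]
    refine csSup_le ⟨0, zero_mem_intervalValues hf⟩ ?_
    rintro _ ⟨h, ⟨h0, h1⟩, rfl⟩
    rw [le_sub_iff_add_le, ← le_sub_iff_add_le']
    refine csSup_le ⟨0, zero_mem_intervalValues hg⟩ ?_
    rintro _ ⟨h', ⟨h0', h1'⟩, rfl⟩
    rw [le_sub_iff_add_le', ← map_add]
    exact le_csSup (hL.bddAbove _) ⟨_, ⟨add_nonneg h0 h0', add_le_add h1 h1'⟩, rfl⟩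

lemma IsSupBounded.posValue_smul_le (hL : IsSupBounded L C) {f : C_c(X, ℝ)} (hf : 0 ≤ f) {c : ℝ}
    (hc : 0 < c) : c * posValue L f ≤ posValue L (c • f) := by
  rw [← le_div_iff₀' hc]
  refine csSup_le ⟨0, zero_mem_intervalValues hf⟩ ?_
  rintro _ ⟨h, ⟨h0, h1⟩, rfl⟩
  rw [le_div_iff₀' hc, ← smul_eq_mul, ← map_smul]
  refine le_csSup (hL.bddAbove _) ⟨_, ⟨fun x => ?_, fun x => ?_⟩, rfl⟩
  · simpa using mul_nonneg hc.le (h0 x)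
  · simpa using mul_le_mul_of_nonneg_left (h1 x) hc.le

lemma IsSupBounded.posValue_smul (hL : IsSupBounded L C) {f : C_c(X, ℝ)} (hf : 0 ≤ f) {c : ℝ}
    (hc : 0 ≤ c) : posValue L (c • f) = c * posValue L f := by
  rcases hc.eq_or_lt with rfl | hc
  · have h0 : (0 : C_c(X, ℝ)) ≤ 0 := le_rfl
    have := hL.posValue_le h0 (le_refl (0 : ℝ)) (fun x => by simp)
    have h1 := hL.posValue_nonneg h0
    rw [zero_smul, zero_mul]
    linarith
  · refine le_antisymm ?_ (hL.posValue_smul_le hf hc)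
    -- The reverse inequality is the same one for the factor `c⁻¹` and the function `c • f`.
    have hcf : 0 ≤ c • f := fun x => by simpa using mul_nonneg hc.le (hf x)
    have := hL.posValue_smul_le hcf (inv_pos.2 hc)
    rwa [smul_smul, inv_mul_cancel₀ hc.ne', one_smul, inv_mul_le_iff₀ hc] at this

/-- The positive part of a bounded linear functional. -/
def posFunctional (hL : IsSupBounded L C) : C_c(X, ℝ≥0) →ₗ[ℝ≥0] ℝ≥0 where
  toFun f := .mk (posValue L f.toReal) (hL.posValue_nonneg toReal_nonneg)
  map_add' f g := by
    ext
    simp [hL.posValue_add]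
  map_smul' c f := by
    ext
    have : (c • f).toReal = (c : ℝ) • f.toReal := by
      ext; simp [NNReal.smul_def]
    simp [this, hL.posValue_smul]

/-- The negative part of a bounded linear functional. -/
def negFunctional (hL : IsSupBounded L C) : C_c(X, ℝ≥0) →ₗ[ℝ≥0] ℝ≥0 where
  toFun f := .mk (posValue L f.toReal - L f.toReal)
    (sub_nonneg.2 (hL.le_posValue toReal_nonneg))
  map_add' f g := by
    ext
    simp [hL.posValue_add]
    ring
  map_smul' c f := by
    ext
    have : (c • f).toReal = (c : ℝ) • f.toReal := by
      ext; simp [NNReal.smul_def]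
    simp [this, hL.posValue_smul]
    ring

lemma coe_posFunctional (hL : IsSupBounded L C) (f : C_c(X, ℝ≥0)) :
    (posFunctional hL f : ℝ) = posValue L f.toReal := rfl

lemma coe_negFunctional (hL : IsSupBounded L C) (f : C_c(X, ℝ≥0)) :
    (negFunctional hL f : ℝ) = posValue L f.toReal - L f.toReal := rfl

variable [T2Space X] [LocallyCompactSpace X] [MeasurableSpace X] [BorelSpace X]

/-- By inner regularity it suffices to bound compact sets, and a cutoff equal to one on `K` gives a
bound by `C`. -/
lemma isFiniteMeasure_rieszMeasure (Λ : C_c(X, ℝ≥0) →ₗ[ℝ≥0] ℝ≥0) {C : ℝ≥0}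
    (hΛ : ∀ f, (∀ x, f x ≤ 1) → Λ f ≤ C) : IsFiniteMeasure (NNRealRMK.rieszMeasure Λ) := by
  refine ⟨lt_of_le_of_lt (b := (C : ℝ≥0∞)) ?_ ENNReal.coe_lt_top⟩
  rw [isOpen_univ.measure_eq_iSup_isCompact]
  refine iSup₂_le fun K _ => iSup_le fun hK => ?_
  obtain ⟨f, hf1, _, hfc, hf⟩ := exists_continuous_one_zero_of_isCompact hK
    (isClosed_empty (X := X)) (Set.disjoint_empty K)
  let g : C_c(X, ℝ≥0) := (⟨f, hfc⟩ : C_c(X, ℝ)).nnrealPart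
  have hg : ∀ x, g x ≤ 1 := fun x => by
    simpa [g, nnrealPart_apply] using (hf x).2
  refine le_trans ?_ (ENNReal.coe_le_coe.2 (hΛ g hg))
  rw [← NNRealRMK.lintegral_rieszMeasure]
  calc NNRealRMK.rieszMeasure Λ K = ∫⁻ x in K, 1 ∂NNRealRMK.rieszMeasure Λ := by simp
    _ ≤ ∫⁻ x in K, g x ∂NNRealRMK.rieszMeasure Λ := by
      refine setLIntegral_mono' hK.measurableSet fun x hx => ?_
      have := hf1 hx
      simp only [Pi.one_apply] at this
      simp [g, nnrealPart_apply, this]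
    _ ≤ _ := setLIntegral_le_lintegral _ _

/-- A linear functional on `C_c(X)` which is bounded for the supremum norm is the difference of two
finite measures. -/
lemma IsSupBounded.exists_measure (hL : IsSupBounded L C) :
    ∃ μ ν : Measure X, IsFiniteMeasure μ ∧ IsFiniteMeasure ν ∧
      ∀ f : C_c(X, ℝ), L f = ∫ x, f x ∂μ - ∫ x, f x ∂ν := by
  have hC : 0 ≤ C := by
    have := hL 0 1 zero_le_one (fun x => by simp)
    simpa using this
  have hb : ∀ f : C_c(X, ℝ≥0), (∀ x, f x ≤ 1) → ∀ x, f.toReal x ≤ 1 := fun f hf x => by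
    simpa using hf x
  refine ⟨NNRealRMK.rieszMeasure (posFunctional hL), NNRealRMK.rieszMeasure (negFunctional hL),
    isFiniteMeasure_rieszMeasure (C := .mk C hC) _ fun f hf => ?_,
    isFiniteMeasure_rieszMeasure (C := .mk (2 * C) (by positivity)) _ fun f hf => ?_, fun f => ?_⟩
  · rw [← NNReal.coe_le_coe]
    simpa [coe_posFunctional] using hL.posValue_le (f := f.toReal) toReal_nonneg zero_le_one (hb f hf)
  -- The constant is `2 * C` here: the negative part is the positive part minus `L`, and each
  -- contributes at most `C`.
  · rw [← NNReal.coe_le_coe]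
    have h1 := hL.posValue_le (f := f.toReal) toReal_nonneg zero_le_one (hb f hf)
    have h2 := hL (-f.toReal) 1 zero_le_one fun x => by
      simpa [abs_of_nonneg] using hf x
    simp only [map_neg] at h2
    rw [coe_negFunctional, NNReal.coe_mk]
    linarith
  · have key : ∀ g : C_c(X, ℝ≥0), L g.toReal =
        ∫ x, (g x : ℝ) ∂NNRealRMK.rieszMeasure (posFunctional hL) -
        ∫ x, (g x : ℝ) ∂NNRealRMK.rieszMeasure (negFunctional hL) := fun g => by
      rw [NNRealRMK.integral_rieszMeasure, NNRealRMK.integral_rieszMeasure]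
      simp [coe_posFunctional, coe_negFunctional]
    have hi : ∀ (g : C_c(X, ℝ≥0)) (Λ : C_c(X, ℝ≥0) →ₗ[ℝ≥0] ℝ≥0),
        Integrable (fun x => (g x : ℝ)) (NNRealRMK.rieszMeasure Λ) := fun g Λ => by
      have := g.toReal.continuous.integrable_of_hasCompactSupport (μ := NNRealRMK.rieszMeasure Λ)
        g.toReal.hasCompactSupport
      exact this.congr (by filter_upwards with x; simp)
    have hf : ∀ x, f x = (f.nnrealPart x : ℝ) - ((-f).nnrealPart x : ℝ) := fun x => by
      conv_lhs => rw [← nnrealPart_sub_nnrealPart_neg f]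
      simp
    simp_rw [hf]
    rw [integral_sub (hi _ _) (hi _ _), integral_sub (hi _ _) (hi _ _)]
    conv_lhs => rw [← nnrealPart_sub_nnrealPart_neg f]
    rw [map_sub, key, key]
    ring

end Riesz

/-! ### The total variation as a supremum over test functions -/

section SmoothApproximation

open scoped ContDiff

/-- Smoothing at a scale below both the modulus of uniform continuity for `δ` and the distance by
which the support can be thickened inside `U`. -/
lemma exists_contDiff_near {F E : Type*} [NormedAddCommGroup F] [NormedSpace ℝ F]
    [FiniteDimensional ℝ F] [NormedAddCommGroup E] [NormedSpace ℝ E] [CompleteSpace E]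
    {U : Set F} (hU : IsOpen U) {f : F → E}
    (hf : Continuous f) (hfc : HasCompactSupport f) (hfU : tsupport f ⊆ U) {δ : ℝ} (hδ : 0 < δ) :
    ∃ g : F → E, ContDiff ℝ ∞ g ∧ HasCompactSupport g ∧ tsupport g ⊆ U ∧
      ∀ x, ‖g x - f x‖ ≤ δ := by
  obtain ⟨r₁, hr₁, h₁⟩ := Metric.uniformContinuous_iff.1 (hfc.uniformContinuous_of_continuous hf)
    δ hδ
  obtain ⟨r₂, hr₂, h₂⟩ := hfc.isCompact.exists_cthickening_subset_open hU hfU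
  obtain ⟨g, hg, h⟩ := hf.exists_contDiff_dist_le_of_forall_mem_ball_dist_le (lt_min hr₁ hr₂)
  have hsub : tsupport g ⊆ Metric.cthickening r₂ (tsupport f) := by
    refine closure_minimal (fun a ha => ?_) Metric.isClosed_cthickening
    by_contra hna
    have hz : ∀ x ∈ Metric.ball a (min r₁ r₂), f x = 0 := fun x hx => by
      by_contra hx0
      apply hna
      refine Metric.thickening_subset_cthickening _ _ (Metric.mem_thickening_iff.2
        ⟨x, subset_tsupport f hx0, ?_⟩)
      rw [dist_comm]
      exact (Metric.mem_ball.1 hx).trans_le (min_le_right _ _)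
    have ha0 := hz a (Metric.mem_ball_self (lt_min hr₁ hr₂))
    -- The oscillation estimate with bound zero: `g` vanishes at the centre of a ball on which `f`
    -- vanishes.
    have := h a 0 fun x hx => by rw [hz x hx, ha0, dist_self]
    rw [ha0, dist_le_zero] at this
    exact ha this
  refine ⟨g, hg, HasCompactSupport.of_support_subset_isCompact hfc.isCompact.cthickening
    ((subset_tsupport g).trans hsub), hsub.trans h₂, fun x => ?_⟩
  rw [← dist_eq_norm]
  exact h x δ fun y hy => (h₁ ((Metric.mem_ball.1 hy).trans_le (min_le_left _ _))).le

lemma exists_contDiff_integral_sub_le {F E : Type*} [NormedAddCommGroup F] [NormedSpace ℝ F]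
    [FiniteDimensional ℝ F] [MeasurableSpace F] [BorelSpace F] [NormedAddCommGroup E]
    [NormedSpace ℝ E] [CompleteSpace E] (U : Opens F) {m : Measure U} [IsFiniteMeasure m]
    {h : U → E} (hh : Integrable h m) {ε : ℝ} (hε : 0 < ε) :
    ∃ g : F → E, ContDiff ℝ ∞ g ∧ HasCompactSupport g ∧ tsupport g ⊆ U ∧
      ∫ x, ‖h x - g x‖ ∂m ≤ ε := by
  have : LocallyCompactSpace U := U.isOpen.locallyCompactSpace
  have : ProperSpace F := FiniteDimensional.proper ℝ F
  obtain ⟨ψ, hψc, hψi, hψ, hψm⟩ := hh.exists_hasCompactSupport_integral_sub_le (half_pos hε)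
  let f : F → E := Function.extend ((↑) : U → F) ψ 0
  have hf : Continuous f := hψc.continuous_extend_zero U.isOpen hψ
  have hfc : HasCompactSupport f := hψc.extend_zero continuous_subtype_val
  have hfU : tsupport f ⊆ U := (hψc.tsupport_extend_zero_subset continuous_subtype_val).trans
    (Subtype.coe_image_subset _ _)
  have hf' : ∀ x : U, f x = ψ x := fun x => Subtype.val_injective.extend_apply _ _ x
  set M := m.real Set.univ
  have hM : 0 ≤ M := measureReal_nonneg
  obtain ⟨g, hg, hgc, hgU, hgf⟩ := exists_contDiff_near U.isOpen hf hfc hfU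
    (δ := ε / 2 / (M + 1)) (by positivity)
  refine ⟨g, hg, hgc, hgU, ?_⟩
  have hgi : Integrable (fun x : U => g x) m := by
    obtain ⟨C, hC⟩ := hgc.exists_bound_of_continuous hg.continuous
    exact Integrable.of_bound (hg.continuous.comp continuous_subtype_val).aestronglyMeasurable C
      (by filter_upwards with x using hC x)
  calc ∫ x, ‖h x - g x‖ ∂m ≤ ∫ x, (‖h x - ψ x‖ + ε / 2 / (M + 1)) ∂m := by
        refine integral_mono (hh.sub hgi).norm ((hh.sub hψm).norm.add (integrable_const _))
          fun x => ?_
        have h1 := hgf x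
        rw [hf', norm_sub_rev] at h1
        calc ‖h x - g x‖ = ‖(h x - ψ x) + (ψ x - g x)‖ := by congr 1; abel
          _ ≤ _ := (norm_add_le _ _).trans (by simpa using h1)
    _ = ∫ x, ‖h x - ψ x‖ ∂m + M * (ε / 2 / (M + 1)) := by
        have hd : Integrable (fun x => ‖h x - ψ x‖) m := (hh.sub hψm).norm
        rw [integral_add hd (integrable_const _), integral_const, smul_eq_mul]
    _ ≤ ε / 2 + ε / 2 := by
        refine add_le_add hψi ?_
        rw [mul_div_assoc', div_le_iff₀ (by positivity)]
        nlinarith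
    _ = ε := by ring

end SmoothApproximation

/-! ### Duality between the variation of a measure and test functions -/

section DualMass

open scoped ContDiff

variable {N : ℕ} {ι : Type} [Fintype ι]

/-- The pairing of a distribution with a vector of test functions. -/
def pairing (T : 𝓓'(cube N, EuclideanSpace ℝ ι)) (Φ : ι → 𝓓(cube N, ℝ)) : ℝ :=
  ∑ i, T (Φ i) i

/-- The vectors of test functions which are bounded by one. -/
def IsUnitTest (Φ : ι → 𝓓(cube N, ℝ)) : Prop := ∀ x, ∑ i, Φ i x ^ 2 ≤ 1

/-- The total variation of a distribution as a dual norm. -/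
def dualMass (T : 𝓓'(cube N, EuclideanSpace ℝ ι)) : ℝ≥0∞ :=
  ⨆ (Φ : ι → 𝓓(cube N, ℝ)) (_ : IsUnitTest Φ), ENNReal.ofReal (pairing T Φ)

lemma integrable_testFunction (m : Measure (cube N)) [IsFiniteMeasure m] (φ : 𝓓(cube N, ℝ)) :
    Integrable (fun x : cube N => φ x) m := by
  obtain ⟨C, hC⟩ := φ.hasCompactSupport.exists_bound_of_continuous φ.continuous
  exact Integrable.of_bound (φ.continuous.comp continuous_subtype_val).aestronglyMeasurable C
    (by filter_upwards with x using hC x)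

lemma isFiniteMeasure_withDensity_enorm {X E : Type*} [MeasurableSpace X] [NormedAddCommGroup E]
    {m : Measure X} {h : X → E} (hh : Integrable h m) :
    IsFiniteMeasure (m.withDensity fun x => ‖h x‖ₑ) :=
  ⟨by simpa using! hh.2⟩

variable {m : Measure (cube N)} {h : cube N → EuclideanSpace ℝ ι}

lemma integ_withDensityᵥ (hh : Integrable h m) (φ : 𝓓(cube N, ℝ)) :
    integ (m.withDensityᵥ h) (fun x => φ (x : Rn N)) = ∫ x : cube N, φ x • h x ∂m :=
  have := isFiniteMeasure_withDensity_enorm hh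
  integral_withDensityᵥ hh (integrable_testFunction _ φ)

lemma variation_withDensityᵥ_univ (hh : Integrable h m) :
    (m.withDensityᵥ h).variation Set.univ = ENNReal.ofReal (∫ x, ‖h x‖ ∂m) := by
  rw [Measure.variation_withDensityᵥ hh, withDensity_apply _ MeasurableSet.univ,
    Measure.restrict_univ, ofReal_integral_norm_eq_lintegral_enorm hh]

lemma integrable_testFunction_smul (hh : Integrable h m) (φ : 𝓓(cube N, ℝ)) :
    Integrable (fun x : cube N => φ x • h x) m :=
  have := isFiniteMeasure_withDensity_enorm hh
  integrable_smul_of_withDensity hh (integrable_testFunction _ φ)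

lemma pairing_withDensityᵥ {T : 𝓓'(cube N, EuclideanSpace ℝ ι)} (hh : Integrable h m)
    (hT : IsMeas T (m.withDensityᵥ h)) (Φ : ι → 𝓓(cube N, ℝ)) :
    pairing T Φ = ∫ x : cube N, ∑ i, Φ i x * h x i ∂m := by
  have hi : ∀ i, Integrable (fun x : cube N => Φ i x * h x i) m := fun i =>
    (EuclideanSpace.proj (𝕜 := ℝ) i).integrable_comp (integrable_testFunction_smul hh (Φ i))
  rw [integral_finsetSum _ fun i _ => hi i]
  refine Finset.sum_congr rfl fun i _ => ?_
  rw [hT, integ_withDensityᵥ hh]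
  exact ((EuclideanSpace.proj (𝕜 := ℝ) i).integral_comp_comm
    (integrable_testFunction_smul hh (Φ i))).symm

lemma sum_mul_le_norm {a : ι → ℝ} (ha : ∑ i, a i ^ 2 ≤ 1) (b : EuclideanSpace ℝ ι) :
    ∑ i, a i * b i ≤ ‖b‖ := by
  have h1 := real_inner_le_norm (WithLp.toLp 2 a : EuclideanSpace ℝ ι) b
  have h2 : ‖(WithLp.toLp 2 a : EuclideanSpace ℝ ι)‖ ≤ 1 := by
    rw [EuclideanSpace.norm_eq]
    exact Real.sqrt_le_one.2 (by simpa using ha)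
  have h3 : inner ℝ (WithLp.toLp 2 a : EuclideanSpace ℝ ι) b = ∑ i, a i * b i := by
    simp [PiLp.inner_apply, mul_comm]
  rw [← h3]
  exact h1.trans (mul_le_of_le_one_left (norm_nonneg _) h2)

/-- Cauchy–Schwarz under the integral, once the measure is written with a density. -/
lemma dualMass_le_variation {T : 𝓓'(cube N, EuclideanSpace ℝ ι)}
    {μ : VectorMeasure (cube N) (EuclideanSpace ℝ ι)} (hT : IsMeas T μ) :
    dualMass T ≤ μ.variation Set.univ := by
  obtain ⟨m, h, _, hh, rfl⟩ := exists_eq_withDensityᵥ μ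
  refine iSup₂_le fun Φ hΦ => ?_
  rw [variation_withDensityᵥ_univ hh, pairing_withDensityᵥ hh hT]
  refine ENNReal.ofReal_le_ofReal (integral_mono ?_ hh.norm fun x => ?_)
  · exact integrable_finsetSum _ fun i _ => (EuclideanSpace.proj (𝕜 := ℝ) i).integrable_comp
      (integrable_testFunction_smul hh (Φ i))
  · exact sum_mul_le_norm (hΦ x) (h x)

lemma variation_ne_top (μ : VectorMeasure (cube N) (EuclideanSpace ℝ ι)) :
    μ.variation Set.univ ≠ ⊤ := by
  obtain ⟨m, h, _, hh, rfl⟩ := exists_eq_withDensityᵥ μ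
  rw [variation_withDensityᵥ_univ hh]
  exact ENNReal.ofReal_ne_top

/-- The loss incurred by testing `g` with `g / √(‖g‖² + δ²)` instead of the nonsmooth `g / ‖g‖`. -/
lemma norm_sub_le_inv_sqrt (b : ℝ) (hb : 0 ≤ b) {δ : ℝ} (hδ : 0 < δ) :
    b - δ ≤ (√(b ^ 2 + δ ^ 2))⁻¹ * b ^ 2 := by
  have h1 : 0 < √(b ^ 2 + δ ^ 2) := Real.sqrt_pos.2 (by positivity)
  have h2 : √(b ^ 2 + δ ^ 2) ≤ b + δ := Real.sqrt_le_iff.2 ⟨by positivity, by nlinarith⟩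
  have h3 : (b + δ)⁻¹ ≤ (√(b ^ 2 + δ ^ 2))⁻¹ := inv_anti₀ h1 h2
  refine le_trans ?_ (mul_le_mul_of_nonneg_right h3 (by positivity))
  rw [inv_mul_eq_div, le_div_iff₀ (by positivity)]
  nlinarith

/-- The ideal test vector is the direction `h / ‖h‖` of the density. It is replaced by `g / √(‖g‖² +
δ²)`, with `g` smooth, compactly supported in the cube and close to `h` in L¹. -/
lemma variation_le_dualMass {T : 𝓓'(cube N, EuclideanSpace ℝ ι)}
    {μ : VectorMeasure (cube N) (EuclideanSpace ℝ ι)} (hT : IsMeas T μ) :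
    μ.variation Set.univ ≤ dualMass T := by
  obtain ⟨m, h, _, hh, rfl⟩ := exists_eq_withDensityᵥ μ
  rw [variation_withDensityᵥ_univ hh]
  refine ENNReal.le_of_forall_pos_le_add fun ε hε _ => ?_
  set M := m.real Set.univ
  have hM : 0 ≤ M := measureReal_nonneg
  set δ : ℝ := ε / 2 / (M + 1)
  have hδ : 0 < δ := by positivity
  obtain ⟨g, hg, hgc, hgU, hgh⟩ := exists_contDiff_integral_sub_le (cube N) hh
    (ε := ε / 4) (by positivity)
  let s : Rn N → ℝ := fun x => (√(‖g x‖ ^ 2 + δ ^ 2))⁻¹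
  have hs0 : ∀ x, 0 < ‖g x‖ ^ 2 + δ ^ 2 := fun x => by positivity
  have hs : ContDiff ℝ ∞ s :=
    ((hg.norm_sq ℝ).add contDiff_const).sqrt (fun x => (hs0 x).ne') |>.inv
      fun x => (Real.sqrt_pos.2 (hs0 x)).ne'
  have hgi : ∀ i, ContDiff ℝ ∞ fun x => g x i := fun i =>
    (EuclideanSpace.proj (𝕜 := ℝ) i).contDiff.comp hg
  have hsub : ∀ i, Function.support (fun x => s x * g x i) ⊆ Function.support g := fun i x hx hx0 =>
    hx (by simp [hx0])
  let Φ : ι → 𝓓(cube N, ℝ) := fun i =>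
    { toFun := fun x => s x * g x i
      contDiff' := hs.mul (hgi i)
      hasCompactSupport' := hgc.mono (hsub i)
      tsupport_subset' := (closure_mono (hsub i)).trans hgU }
  have hΦ : ∀ i x, Φ i x = s x * g x i := fun i x => rfl
  have hsum : ∀ x, ∑ i, g x i ^ 2 = ‖g x‖ ^ 2 := fun x => by
    rw [EuclideanSpace.norm_sq_eq]; simp
  have hunit : IsUnitTest Φ := fun x => by
    simp_rw [hΦ, mul_pow]
    rw [← Finset.mul_sum, hsum, inv_pow, Real.sq_sqrt (hs0 x).le, inv_mul_le_iff₀ (hs0 x)]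
    nlinarith
  refine le_trans ?_ (add_le_add_left (le_iSup₂ (f := fun (Φ : ι → 𝓓(cube N, ℝ)) (_ : IsUnitTest Φ)
    => ENNReal.ofReal (pairing T Φ)) Φ hunit) _)
  rw [← ENNReal.ofReal_coe_nnreal, pairing_withDensityᵥ hh hT]
  refine le_trans (ENNReal.ofReal_le_ofReal ?_) ENNReal.ofReal_add_le
  have hgm : Integrable (fun x : cube N => g x) m := by
    obtain ⟨C, hC⟩ := hgc.exists_bound_of_continuous hg.continuous
    exact Integrable.of_bound (hg.continuous.comp continuous_subtype_val).aestronglyMeasurable C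
      (by filter_upwards with x using hC x)
  have hint : Integrable (fun x : cube N => ∑ i, Φ i x * h x i) m :=
    integrable_finsetSum _ fun i _ => (EuclideanSpace.proj (𝕜 := ℝ) i).integrable_comp
      (integrable_testFunction_smul hh (Φ i))
  -- `h` is exchanged for `g` twice, in the norm and in the pairing. The total error is `2 * (ε /
  -- 4)` plus at most `ε / 2` from `δ`.
  have hpt : ∀ x : cube N, ‖h x‖ ≤ ∑ i, Φ i x * h x i + 2 * ‖h x - g x‖ + δ := fun x => by
    have h1 := sum_mul_le_norm (hunit x) (g x - h x)
    have h2 : ∑ i, Φ i x * (g x - h x) i = ∑ i, Φ i x * g x i - ∑ i, Φ i x * h x i := by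
      simp [mul_sub]
    have h3 : ∑ i, Φ i x * g x i = s x * ‖g x‖ ^ 2 := by
      rw [← hsum, Finset.mul_sum]
      exact Finset.sum_congr rfl fun i _ => by rw [hΦ]; ring
    have h4 := norm_sub_le_inv_sqrt ‖g x‖ (norm_nonneg _) hδ
    have h5 : ‖h x‖ ≤ ‖g x‖ + ‖h x - g x‖ := by
      simpa using norm_add_le (g x) (h x - g x)
    rw [h2, h3, norm_sub_rev] at h1
    have h6 : s x * ‖g x‖ ^ 2 = (√(‖g x‖ ^ 2 + δ ^ 2))⁻¹ * ‖g x‖ ^ 2 := rfl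
    linarith
  have hI := integral_mono (μ := m) hh.norm
    ((hint.add ((hh.sub hgm).norm.const_mul 2)).add (integrable_const δ)) hpt
  have hI2 : ∫ x : cube N, (∑ i, Φ i x * h x i + 2 * ‖h x - g x‖ + δ) ∂m =
      ∫ x : cube N, ∑ i, Φ i x * h x i ∂m + 2 * ∫ x : cube N, ‖h x - g x‖ ∂m + M * δ := by
    have hd : Integrable (fun x : cube N => 2 * ‖h x - g x‖) m := (hh.sub hgm).norm.const_mul 2
    have he : Integrable (fun x : cube N => ∑ i, Φ i x * h x i + 2 * ‖h x - g x‖) m := hint.add hd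
    rw [integral_add he (integrable_const δ), integral_add hint hd, integral_const_mul, integral_const,
      smul_eq_mul]
  have h7 : M * δ ≤ ε / 2 := by
    simp only [δ]
    rw [mul_div_assoc', div_le_iff₀ (by positivity)]
    nlinarith [ε.coe_nonneg]
  refine hI.trans (hI2.le.trans ?_)
  linarith

end DualMass

/-! ### Distributions of order zero are measures; calculus of the total variation -/

section MassFormula

open CompactlySupported BoundedContinuousFunction

variable {N : ℕ} {ι : Type} [Fintype ι]

lemma pairing_single (T : 𝓓'(cube N, EuclideanSpace ℝ ι)) [DecidableEq ι] (i : ι)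
    (φ : 𝓓(cube N, ℝ)) : pairing T (Pi.single i φ) = T φ i := by
  rw [pairing, Finset.sum_eq_single i]
  · simp
  · intro j _ hj
    simp [Pi.single_eq_of_ne hj]
  · simp

lemma pairing_smul_right (T : 𝓓'(cube N, EuclideanSpace ℝ ι)) (c : ℝ) (Φ : ι → 𝓓(cube N, ℝ)) :
    pairing T (c • Φ) = c * pairing T Φ := by
  simp [pairing, Finset.mul_sum]

lemma ofReal_pairing_le_dualMass (T : 𝓓'(cube N, EuclideanSpace ℝ ι)) {Φ : ι → 𝓓(cube N, ℝ)}
    {R : ℝ} (hR : 0 ≤ R) (hΦ : ∀ x, ∑ i, Φ i x ^ 2 ≤ R ^ 2) :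
    ENNReal.ofReal (pairing T Φ) ≤ ENNReal.ofReal R * dualMass T := by
  rcases hR.eq_or_lt with rfl | hR
  -- For `R = 0` the right side is zero even when `dualMass T = ⊤`, so `Φ` itself has to vanish.
  · have : Φ = 0 := by
      funext i
      ext x
      have h1 : ∑ i, Φ i x ^ 2 = 0 :=
        le_antisymm (by simpa using hΦ x) (Finset.sum_nonneg fun _ _ => sq_nonneg _)
      have := (Finset.sum_eq_zero_iff_of_nonneg fun _ _ => sq_nonneg _).1 h1 i (Finset.mem_univ i)
      simpa using this
    simp [this, pairing]
  · have hu : IsUnitTest (R⁻¹ • Φ) := fun x => by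
      simp only [Pi.smul_apply, FunLike.coe_smul, smul_eq_mul, mul_pow, inv_pow]
      rw [← Finset.mul_sum, inv_mul_le_iff₀ (by positivity), mul_one]
      exact hΦ x
    have := le_iSup₂ (f := fun (Φ : ι → 𝓓(cube N, ℝ)) (_ : IsUnitTest Φ) =>
      ENNReal.ofReal (pairing T Φ)) _ hu
    have h2 : pairing T Φ = R * pairing T (R⁻¹ • Φ) := by
      rw [pairing_smul_right, mul_inv_cancel_left₀ hR.ne']
    rw [h2, ENNReal.ofReal_mul hR.le]
    exact mul_le_mul_right this _

/-- The restriction of a test function to `Q`, as a bounded continuous function. -/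
def restrictTest : 𝓓(cube N, ℝ) →ₗ[ℝ] (cube N →ᵇ ℝ) where
  toFun φ := (φ : BoundedContinuousFunction (Rn N) ℝ).compContinuous ⟨_, continuous_subtype_val⟩
  map_add' φ ψ := by ext x; simp
  map_smul' c φ := by ext x; simp

lemma testFunction_eq_zero (φ : 𝓓(cube N, ℝ)) {x : Rn N} (hx : x ∉ (cube N : Set (Rn N))) :
    φ x = 0 := by
  by_contra h
  exact hx (φ.tsupport_subset (subset_tsupport _ h))

lemma abs_testFunction_le (φ : 𝓓(cube N, ℝ)) (x : Rn N) : |φ x| ≤ ‖restrictTest φ‖ := by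
  by_cases hx : x ∈ (cube N : Set (Rn N))
  · exact (restrictTest φ).norm_coe_le_norm ⟨x, hx⟩
  · rw [testFunction_eq_zero φ hx, abs_zero]
    exact norm_nonneg _

lemma restrictTest_injective : Function.Injective (restrictTest (N := N)) := by
  rw [← LinearMap.ker_eq_bot, LinearMap.ker_eq_bot']
  intro φ h
  ext x
  have := abs_testFunction_le φ x
  rw [h, norm_zero] at this
  simpa using this

/-- The restriction of a test function to `Q`, as a compactly supported function. -/
def restrictTestCc (φ : 𝓓(cube N, ℝ)) : C_c(cube N, ℝ) where
  toFun x := φ x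
  continuous_toFun := φ.continuous.comp continuous_subtype_val
  hasCompactSupport' := by
    have hK : IsCompact (((↑) : cube N → Rn N) ⁻¹' tsupport φ) := by
      have himg : ((↑) : cube N → Rn N) '' (((↑) : cube N → Rn N) ⁻¹' tsupport φ) = tsupport φ :=
        Set.image_preimage_eq_of_subset (by simpa using φ.tsupport_subset)
      exact Topology.IsInducing.subtypeVal.isCompact_iff.2
        ((congrArg IsCompact himg).mpr φ.hasCompactSupport.isCompact)
    refine HasCompactSupport.intro hK fun x hx => ?_
    by_contra h
    exact hx (subset_tsupport φ h)

/-- A scalar distribution of order zero is a difference of finite measures. -/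
lemma exists_measure_of_bounded (T : 𝓓(cube N, ℝ) →ₗ[ℝ] ℝ) {C : ℝ} (hC : 0 ≤ C)
    (hT : ∀ φ M, 0 ≤ M → (∀ x, |φ x| ≤ M) → T φ ≤ C * M) :
    ∃ μ ν : Measure (cube N), IsFiniteMeasure μ ∧ IsFiniteMeasure ν ∧
      ∀ φ, T φ = ∫ x : cube N, φ x ∂μ - ∫ x : cube N, φ x ∂ν := by
  have : LocallyCompactSpace (cube N) := (cube N).isOpen.locallyCompactSpace
  let e := LinearEquiv.ofInjective restrictTest (restrictTest_injective (N := N))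
  let F : LinearMap.range (restrictTest (N := N)) →ₗ[ℝ] ℝ := T ∘ₗ e.symm.toLinearMap
  have hF : ∀ φ, F (e φ) = T φ := fun φ => by simp [F]
  have hb : ∀ x, ‖F x‖ ≤ C * ‖x‖ := fun x => by
    obtain ⟨φ, rfl⟩ := e.surjective x
    have h1 := hF φ
    have h2 : ‖e φ‖ = ‖restrictTest φ‖ := rfl
    rw [h1, h2, Real.norm_eq_abs, abs_le']
    refine ⟨hT φ _ (norm_nonneg _) (abs_testFunction_le φ), ?_⟩
    rw [← map_neg]
    exact hT _ _ (norm_nonneg _) fun x => by simpa using abs_testFunction_le φ x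
  -- Hahn–Banach extends `T` from the test functions, seen as a subspace of the bounded continuous
  -- functions, with the same sup-norm bound; restricted to `C_c`, the extension falls under Riesz
  -- representation.
  obtain ⟨g, hg, hgn⟩ := exists_extension_norm_eq (𝕜 := ℝ) _ (F.mkContinuous C hb)
  have hgC : ‖g‖ ≤ C := hgn ▸ LinearMap.mkContinuous_norm_le _ hC hb
  let L : C_c(cube N, ℝ) →ₗ[ℝ] ℝ :=
    { toFun := fun f => g (f : cube N →ᵇ ℝ)
      map_add' := fun f f' => by
        rw [← map_add]; rfl
      map_smul' := fun c f => by
        rw [RingHom.id_apply, ← map_smul]; rfl }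
  have hL : IsSupBounded L C := fun f M hM hf => by
    refine (le_abs_self _).trans ((g.le_opNorm _).trans ?_)
    exact mul_le_mul hgC ((BoundedContinuousFunction.norm_le hM).2 hf) (norm_nonneg _) hC
  obtain ⟨μ, ν, hμ, hν, h⟩ := hL.exists_measure
  refine ⟨μ, ν, hμ, hν, fun φ => ?_⟩
  refine Eq.trans ?_ (h (restrictTestCc φ))
  have h3 := hg (e φ)
  rw [LinearMap.mkContinuous_apply, hF] at h3
  exact h3.symm

/-- Each coordinate is bounded in the supremum norm, hence a difference of finite measures. Their
densities with respect to the sum of all these measures are the coordinates of one vector density.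
-/
lemma exists_isMeas_of_dualMass_ne_top (T : 𝓓'(cube N, EuclideanSpace ℝ ι))
    (hT : dualMass T ≠ ⊤) : ∃ μ, IsMeas T μ := by
  classical
  have hb : ∀ (i : ι) (φ : 𝓓(cube N, ℝ)) (M : ℝ), 0 ≤ M → (∀ x, |φ x| ≤ M) →
      T φ i ≤ (dualMass T).toReal * M := fun i φ M hM hφ => by
    have h1 := ofReal_pairing_le_dualMass T (Φ := Pi.single i φ) hM fun x => by
      rw [Finset.sum_eq_single i]
      · rw [Pi.single_eq_same, ← sq_abs]
        exact pow_le_pow_left₀ (abs_nonneg _) (hφ x) 2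
      · intro j _ hj
        simp [Pi.single_eq_of_ne hj]
      · simp
    rw [pairing_single, ← ENNReal.ofReal_toReal hT, ← ENNReal.ofReal_mul hM,
      ENNReal.ofReal_le_ofReal_iff (by positivity)] at h1
    linarith
  have hex := fun i => exists_measure_of_bounded
    ((EuclideanSpace.proj (𝕜 := ℝ) i).toLinearMap ∘ₗ (T : 𝓓(cube N, ℝ) →ₗ[ℝ] EuclideanSpace ℝ ι))
    ENNReal.toReal_nonneg (hb i)
  choose μ ν hμ hν h using hex
  let m : Measure (cube N) := ∑ i, (μ i + ν i)
  have hle : ∀ i, μ i + ν i ≤ m := fun i =>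
    Finset.single_le_sum (f := fun i => μ i + ν i) (fun _ _ => Measure.zero_le _)
      (Finset.mem_univ i)
  have hμm : ∀ i, μ i ≪ m := fun i =>
    (Measure.le_add_right le_rfl |>.trans (hle i)).absolutelyContinuous
  have hνm : ∀ i, ν i ≪ m := fun i =>
    (Measure.le_add_left le_rfl |>.trans (hle i)).absolutelyContinuous
  let d : ι → cube N → ℝ := fun i x =>
    ((μ i).rnDeriv m x).toReal - ((ν i).rnDeriv m x).toReal
  let g : cube N → EuclideanSpace ℝ ι := fun x => WithLp.toLp 2 fun i => d i x
  have hd : ∀ i, Integrable (d i) m := fun i =>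
    Measure.integrable_toReal_rnDeriv.sub Measure.integrable_toReal_rnDeriv
  have hg : Integrable g m := by
    have : g = fun x => ∑ i, d i x • EuclideanSpace.single i (1 : ℝ) := by
      ext x i
      simp [g, Pi.single_apply]
    rw [this]
    exact integrable_finsetSum _ fun i _ => (hd i).smul_const _
  refine ⟨m.withDensityᵥ g, fun φ => ?_⟩
  rw [integ_withDensityᵥ hg]
  ext i
  have h1 : (∫ x : cube N, φ x • g x ∂m) i = ∫ x : cube N, d i x * φ x ∂m := by
    refine ((EuclideanSpace.proj (𝕜 := ℝ) i).integral_comp_comm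
      (integrable_testFunction_smul hg φ)).symm.trans ?_
    simp [g, mul_comm]
  rw [h1]
  refine (h i φ).trans ?_
  rw [← integral_rnDeriv_smul (hμm i), ← integral_rnDeriv_smul (hνm i), ← integral_sub]
  · simp [d, sub_mul]
  · exact (integrable_rnDeriv_smul_iff (hμm i)).2 (integrable_testFunction _ φ)
  · exact (integrable_rnDeriv_smul_iff (hνm i)).2 (integrable_testFunction _ φ)

/-- The total variation of a distribution is a supremum over test functions. -/
theorem mass_eq_dualMass (T : 𝓓'(cube N, EuclideanSpace ℝ ι)) : mass T = dualMass T := by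
  refine le_antisymm ?_ (le_iInf₂ fun μ hμ => dualMass_le_variation hμ)
  by_cases hT : dualMass T = ⊤
  · rw [hT]; exact le_top
  · obtain ⟨μ, hμ⟩ := exists_isMeas_of_dualMass_ne_top T hT
    exact (iInf₂_le μ hμ).trans (variation_le_dualMass hμ)

theorem exists_isMeas_iff (T : 𝓓'(cube N, EuclideanSpace ℝ ι)) :
    (∃ μ, IsMeas T μ) ↔ mass T ≠ ⊤ := by
  rw [mass_eq_dualMass]
  refine ⟨?_, exists_isMeas_of_dualMass_ne_top T⟩
  rintro ⟨μ, hμ⟩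
  exact ne_top_of_le_ne_top (variation_ne_top μ) (dualMass_le_variation hμ)

variable {T T' : 𝓓'(cube N, EuclideanSpace ℝ ι)}

lemma mass_le_iff {c : ℝ≥0∞} :
    mass T ≤ c ↔ ∀ Φ, IsUnitTest Φ → ENNReal.ofReal (pairing T Φ) ≤ c := by
  rw [mass_eq_dualMass, dualMass, iSup₂_le_iff]

lemma ofReal_pairing_le {Φ : ι → 𝓓(cube N, ℝ)} {R : ℝ} (hR : 0 ≤ R)
    (hΦ : ∀ x, ∑ i, Φ i x ^ 2 ≤ R ^ 2) :
    ENNReal.ofReal (pairing T Φ) ≤ ENNReal.ofReal R * mass T := by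
  rw [mass_eq_dualMass]
  exact ofReal_pairing_le_dualMass T hR hΦ

lemma ofReal_pairing_le_mass {Φ : ι → 𝓓(cube N, ℝ)} (hΦ : IsUnitTest Φ) :
    ENNReal.ofReal (pairing T Φ) ≤ mass T := mass_le_iff.1 le_rfl Φ hΦ

variable (T T') in
lemma mass_add_le : mass (T + T') ≤ mass T + mass T' := by
  refine mass_le_iff.2 fun Φ hΦ => ?_
  have : pairing (T + T') Φ = pairing T Φ + pairing T' Φ := by
    simp [pairing, Finset.sum_add_distrib]
  rw [this]
  exact ENNReal.ofReal_add_le.trans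
    (add_le_add (ofReal_pairing_le_mass hΦ) (ofReal_pairing_le_mass hΦ))

variable (T) in
lemma mass_smul_le (c : ℝ) : mass (c • T) ≤ ENNReal.ofReal |c| * mass T := by
  refine mass_le_iff.2 fun Φ hΦ => ?_
  have : pairing (c • T) Φ = pairing T (c • Φ) := by
    simp [pairing]
  rw [this]
  refine ofReal_pairing_le (abs_nonneg c) fun x => ?_
  have := hΦ x
  simp only [Pi.smul_apply, FunLike.coe_smul, smul_eq_mul, mul_pow, sq_abs]
  rw [← Finset.mul_sum]
  nlinarith [sq_nonneg c]

variable (T) in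
lemma mass_neg : mass (-T) = mass T := by
  have key : ∀ T : 𝓓'(cube N, EuclideanSpace ℝ ι), mass (-T) ≤ mass T := fun T => by
    have := mass_smul_le T (-1)
    have e : (-1 : ℝ) • T = -T := by
      ext φ
      simp
    rwa [e, abs_neg, abs_one, ENNReal.ofReal_one, one_mul] at this
  refine le_antisymm (key T) ?_
  simpa using key (-T)

variable (T T') in
lemma mass_sub_le : mass (T - T') ≤ mass T + mass T' := by
  rw [sub_eq_add_neg, ← mass_neg T']
  exact mass_add_le _ _

lemma mass_zero : mass (0 : 𝓓'(cube N, EuclideanSpace ℝ ι)) = 0 := by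
  refine le_antisymm (mass_le_iff.2 fun Φ _ => ?_) zero_le
  simp [pairing]

/-- The total variation is lower semicontinuous. -/
lemma mass_le_of_tendsto {α : Type*} {l : Filter α} [l.NeBot]
    {S : α → 𝓓'(cube N, EuclideanSpace ℝ ι)} {c : ℝ≥0∞}
    (hS : ∀ φ, Tendsto (fun n => S n φ) l (𝓝 (T φ)))
    (hc : Tendsto (fun n => mass (S n)) l (𝓝 c)) : mass T ≤ c := by
  refine mass_le_iff.2 fun Φ hΦ => ?_
  have h1 : Tendsto (fun n => pairing (S n) Φ) l (𝓝 (pairing T Φ)) :=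
    tendsto_finsetSum _ fun i _ => ((EuclideanSpace.proj (𝕜 := ℝ) i).continuous.tendsto _).comp
      (hS (Φ i))
  exact le_of_tendsto_of_tendsto' (ENNReal.tendsto_ofReal h1) hc
    fun n => ofReal_pairing_le_mass hΦ

lemma pairing_toDistr (v : L1 N (EuclideanSpace ℝ ι)) (Φ : ι → 𝓓(cube N, ℝ)) :
    pairing (toDistr v) Φ = ∫ x, ∑ i, Φ i x * v x i ∂leb N := by
  have hi : ∀ i, Integrable (fun x => Φ i x * v x i) (leb N) := fun i =>
    (EuclideanSpace.proj (𝕜 := ℝ) i).integrable_comp (integrable_ofFun v (Φ i))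
  rw [integral_finsetSum _ fun i _ => hi i]
  refine Finset.sum_congr rfl fun i _ => ?_
  change ofFun v (Φ i) i = _
  rw [ofFun_apply]
  exact ((EuclideanSpace.proj (𝕜 := ℝ) i).integral_comp_comm (integrable_ofFun v (Φ i))).symm

lemma mass_toDistr_le (v : L1 N (EuclideanSpace ℝ ι)) : mass (toDistr v) ≤ ‖v‖ₑ := by
  refine mass_le_iff.2 fun Φ hΦ => ?_
  rw [pairing_toDistr, ← ofReal_norm, MeasureTheory.L1.norm_eq_integral_norm]
  refine ENNReal.ofReal_le_ofReal (integral_mono ?_ (L1.integrable_coeFn v).norm fun x => ?_)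
  · exact integrable_finsetSum _ fun i _ =>
      (EuclideanSpace.proj (𝕜 := ℝ) i).integrable_comp (integrable_ofFun v (Φ i))
  · exact sum_mul_le_norm (hΦ x) (v x)

end MassFormula

/-! ### Regularization by dilation and convolution -/

section Regularization

open scoped Convolution ContDiff Pointwise

variable {N : ℕ}

lemma mem_cube {x : Rn N} : x ∈ (cube N : Set (Rn N)) ↔ ∀ i, |x i| < 1 / 2 := by
  change (∀ i, x i ∈ Set.Ioo (-1 / 2 : ℝ) (1 / 2)) ↔ _
  refine forall_congr' fun i => ?_
  rw [Set.mem_Ioo, abs_lt, neg_div]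

lemma norm_le_of_mem_cube {x : Rn N} (hx : x ∈ (cube N : Set (Rn N))) : ‖x‖ ≤ N := by
  have h1 : ‖x‖ ≤ ∑ i : Fin N, |x i| := by
    rw [EuclideanSpace.norm_eq]
    refine Real.sqrt_le_iff.2 ⟨Finset.sum_nonneg fun _ _ => abs_nonneg _, ?_⟩
    simpa using Finset.sum_sq_le_sq_sum_of_nonneg (s := Finset.univ) (f := fun i => |x i|)
      fun _ _ => abs_nonneg _
  refine h1.trans ((Finset.sum_le_sum fun i _ => (mem_cube.1 hx i).le).trans ?_)
  simp only [Finset.sum_const, Finset.card_univ, Fintype.card_fin, nsmul_eq_mul]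
  have : (0 : ℝ) ≤ N := N.cast_nonneg
  linarith

instance : IsFiniteMeasure (leb N) := by
  refine ⟨?_⟩
  rw [Measure.restrict_apply_univ]
  refine lt_of_le_of_lt (measure_mono fun x hx => ?_)
    (measure_closedBall_lt_top (x := (0 : Rn N)) (r := N))
  simpa using norm_le_of_mem_cube hx

/-- The mollifier which belongs to the dilation factor `t`. -/
def mollifierBump (t : Set.Ioo (0 : ℝ) 1) : ContDiffBump (0 : Rn N) where
  rIn := (1 - t) / 8
  -- Dilation by `t` shrinks the half-width of the cube to `t / 2`, and `t / 2 + (1 - t) / 4 < 1 /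
  -- 2`: the mollified dilate of a test function still has its support in the cube.
  rOut := (1 - t) / 4
  rIn_pos := by have := t.2.2; linarith
  rIn_lt_rOut := by have := t.2.2; linarith

/-- The normalized mollifier which belongs to the dilation factor `t`. -/
def mollifier (t : Set.Ioo (0 : ℝ) 1) : Rn N → ℝ := (mollifierBump t).normed volume

variable (t : Set.Ioo (0 : ℝ) 1)

lemma mollifier_nonneg (x : Rn N) : 0 ≤ mollifier t x := (mollifierBump t).nonneg_normed x

lemma contDiff_mollifier : ContDiff ℝ ∞ (mollifier (N := N) t) := (mollifierBump t).contDiff_normed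

lemma hasCompactSupport_mollifier : HasCompactSupport (mollifier (N := N) t) :=
  (mollifierBump t).hasCompactSupport_normed

lemma integrable_mollifier : Integrable (mollifier (N := N) t) :=
  (mollifierBump t).integrable_normed

lemma integral_mollifier : ∫ x : Rn N, mollifier t x = 1 := (mollifierBump t).integral_normed

lemma mollifier_neg (x : Rn N) : mollifier t (-x) = mollifier t x :=
  (mollifierBump t).normed_neg x

lemma support_mollifier :
    Function.support (mollifier (N := N) t) = Metric.ball 0 ((1 - t) / 4) :=
  (mollifierBump t).support_normed_eq

lemma coe_pos : (0 : ℝ) < t := t.2.1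

lemma coe_pow_pos : (0 : ℝ) < (t : ℝ) ^ N := pow_pos (coe_pos t) N

/-- The dilation of a test function. -/
def dilate (φ : 𝓓(cube N, ℝ)) (w : Rn N) : ℝ := ((t : ℝ) ^ N)⁻¹ * φ ((t : ℝ)⁻¹ • w)

lemma contDiff_dilate (φ : 𝓓(cube N, ℝ)) : ContDiff ℝ ∞ (dilate t φ) :=
  contDiff_const.mul (φ.contDiff.comp (contDiff_const_smul _))

lemma support_dilate_subset (φ : 𝓓(cube N, ℝ)) :
    Function.support (dilate t φ) ⊆ (t : ℝ) • tsupport φ := by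
  intro w hw
  rw [Set.mem_smul_set_iff_inv_smul_mem₀ (coe_pos t).ne']
  refine subset_tsupport φ fun h => hw ?_
  simp [dilate, h]

lemma hasCompactSupport_dilate (φ : 𝓓(cube N, ℝ)) : HasCompactSupport (dilate t φ) :=
  HasCompactSupport.of_support_subset_isCompact (φ.hasCompactSupport.isCompact.smul _)
    (support_dilate_subset t φ)

lemma lineDeriv_testFunction_apply (φ : 𝓓(cube N, ℝ)) (e x : Rn N) :
    (∂_{e} φ) x = fderiv ℝ φ x e := by
  rw [TestFunction.lineDerivOp_eq_lineDerivCLM (𝕜 := ℝ),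
    TestFunction.lineDerivCLM_apply_of_le (by simp),
    (φ.contDiff.differentiable (by simp) _).lineDeriv_eq_fderiv]

lemma fderiv_dilate (φ : 𝓓(cube N, ℝ)) (w e : Rn N) :
    fderiv ℝ (dilate t φ) w e = (t : ℝ)⁻¹ * dilate t (∂_{e} φ) w := by
  have hφ : DifferentiableAt ℝ φ ((t : ℝ)⁻¹ • w) :=
    φ.contDiff.differentiable (by simp) _
  have h1 : HasFDerivAt (dilate t φ) (((t : ℝ) ^ N)⁻¹ •
      ((fderiv ℝ φ ((t : ℝ)⁻¹ • w)).comp ((t : ℝ)⁻¹ • ContinuousLinearMap.id ℝ (Rn N)))) w :=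
    (HasFDerivAt.comp w hφ.hasFDerivAt ((hasFDerivAt_id w).const_smul (t : ℝ)⁻¹)).const_mul
      ((t : ℝ) ^ N)⁻¹
  rw [h1.fderiv, dilate, lineDeriv_testFunction_apply]
  simp
  ring

lemma tsupport_mollifier_convolution_subset (φ : 𝓓(cube N, ℝ)) :
    HasCompactSupport (mollifier t ⋆[ContinuousLinearMap.lsmul ℝ ℝ, volume] dilate t φ) ∧
      tsupport (mollifier t ⋆[ContinuousLinearMap.lsmul ℝ ℝ, volume] dilate t φ) ⊆ cube N := by
  have hK : IsCompact (Metric.closedBall (0 : Rn N) ((1 - t) / 4) + (t : ℝ) • tsupport φ) :=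
    (isCompact_closedBall _ _).add (φ.hasCompactSupport.isCompact.smul _)
  have hsub : Function.support (mollifier t ⋆[ContinuousLinearMap.lsmul ℝ ℝ, volume] dilate t φ) ⊆
      Metric.closedBall (0 : Rn N) ((1 - t) / 4) + (t : ℝ) • tsupport φ := by
    refine (support_convolution_subset _).trans (Set.add_subset_add ?_ (support_dilate_subset t φ))
    rw [support_mollifier]
    exact Metric.ball_subset_closedBall
  refine ⟨HasCompactSupport.of_support_subset_isCompact hK hsub,
    (closure_minimal hsub hK.isClosed).trans ?_⟩
  rintro _ ⟨s, hs, _, ⟨y, hy, rfl⟩, rfl⟩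
  rw [mem_cube]
  intro i
  have h1 := mem_cube.1 (φ.tsupport_subset hy) i
  have h2 : |s i| ≤ (1 - t) / 4 := by
    have := PiLp.norm_apply_le s i
    rw [Real.norm_eq_abs] at this
    exact this.trans (by simpa using hs)
  have h3 := t.2.1
  have h4 := t.2.2
  simp only [PiLp.add_apply, PiLp.smul_apply, smul_eq_mul]
  refine (abs_add_le _ _).trans_lt ?_
  rw [abs_mul, abs_of_pos h3]
  nlinarith

/-- The dual regularization, which maps test functions to test functions. -/
def regTest (φ : 𝓓(cube N, ℝ)) : 𝓓(cube N, ℝ) where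
  toFun := mollifier t ⋆[ContinuousLinearMap.lsmul ℝ ℝ, volume] dilate t φ
  contDiff' := (hasCompactSupport_dilate t φ).contDiff_convolution_right _
    (integrable_mollifier t).locallyIntegrable (contDiff_dilate t φ)
  hasCompactSupport' := (tsupport_mollifier_convolution_subset t φ).1
  tsupport_subset' := (tsupport_mollifier_convolution_subset t φ).2

lemma regTest_apply (φ : 𝓓(cube N, ℝ)) (z : Rn N) :
    regTest t φ z = ∫ s, mollifier t s * dilate t φ (z - s) := rfl

lemma regTest_apply_swap (φ : 𝓓(cube N, ℝ)) (z : Rn N) :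
    regTest t φ z = ∫ s, mollifier t (z - s) * dilate t φ s := by
  change (mollifier t ⋆[ContinuousLinearMap.lsmul ℝ ℝ, volume] dilate t φ) z = _
  rw [convolution_lsmul_swap]
  rfl

/-- The derivative passes to the dilated factor of the convolution, where the chain rule yields
`t⁻¹`. -/
lemma lineDeriv_regTest (φ : 𝓓(cube N, ℝ)) (e : Rn N) :
    ∂_{e} (regTest t φ) = (t : ℝ)⁻¹ • regTest t (∂_{e} φ) := by
  ext z
  have h := (hasCompactSupport_dilate t φ).hasFDerivAt_convolution_right
    (ContinuousLinearMap.lsmul ℝ ℝ) (integrable_mollifier t).locallyIntegrable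
    ((contDiff_dilate t φ).of_le (by simp)) z
  rw [lineDeriv_testFunction_apply]
  change fderiv ℝ (mollifier t ⋆[ContinuousLinearMap.lsmul ℝ ℝ, volume] dilate t φ) z e = _
  rw [h.fderiv, convolution_precompR_apply _ (integrable_mollifier t).locallyIntegrable
    ((hasCompactSupport_dilate t φ).fderiv ℝ) ((contDiff_dilate t φ).continuous_fderiv (by simp))]
  simp only [FunLike.coe_smul, Pi.smul_apply, smul_eq_mul, regTest_apply, fderiv_dilate]
  rw [convolution_def, ← integral_const_mul]
  refine integral_congr_ae (Eventually.of_forall fun s => ?_)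
  simp only [ContinuousLinearMap.lsmul_apply, smul_eq_mul]
  ring

lemma regTest_lineDeriv (φ : 𝓓(cube N, ℝ)) (e : Rn N) :
    regTest t (∂_{e} φ) = (t : ℝ) • ∂_{e} (regTest t φ) := by
  rw [lineDeriv_regTest, smul_smul, mul_inv_cancel₀ (coe_pos t).ne', one_smul]

lemma abs_dilate_le {φ : 𝓓(cube N, ℝ)} {M : ℝ} (hφ : ∀ x, |φ x| ≤ M) (w : Rn N) :
    |dilate t φ w| ≤ ((t : ℝ) ^ N)⁻¹ * M := by
  have := coe_pow_pos (N := N) t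
  rw [dilate, abs_mul, abs_of_pos (by positivity)]
  gcongr
  exact hφ _

/-- The regularized derivatives are bounded by the test function itself. -/
lemma exists_abs_regTest_lineDeriv_le (e : Rn N) : ∃ C, 0 ≤ C ∧
    ∀ (φ : 𝓓(cube N, ℝ)) (M : ℝ), (∀ x, |φ x| ≤ M) → ∀ z, |regTest t (∂_{e} φ) z| ≤ C * M := by
  have ha1 : ContDiff ℝ 1 (mollifier (N := N) t) := (contDiff_mollifier t).of_le (by simp)
  have hac : HasCompactSupport fun x : Rn N => fderiv ℝ (mollifier (N := N) t) x e :=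
    (hasCompactSupport_mollifier (N := N) t).fderiv_apply ℝ e
  have hai : Integrable fun x : Rn N => fderiv ℝ (mollifier (N := N) t) x e :=
    ((ha1.continuous_fderiv (by simp)).clm_apply (continuous_const (y := e))).integrable_of_hasCompactSupport
      hac
  have ht := coe_pos t
  have htN := coe_pow_pos (N := N) t
  refine ⟨t * ((∫ x : Rn N, |fderiv ℝ (mollifier (N := N) t) x e|) * ((t : ℝ) ^ N)⁻¹),
    by positivity, fun φ M hφ z => ?_⟩
  have hb : LocallyIntegrable (dilate t φ) :=
    (contDiff_dilate t φ).continuous.locallyIntegrable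
  -- The factors are exchanged so that the derivative falls on the mollifier; the constant then
  -- involves only `t` and `e`, and no derivative of `φ`.
  have hcomm : (regTest t φ : Rn N → ℝ) =
      dilate t φ ⋆[ContinuousLinearMap.lsmul ℝ ℝ, volume] mollifier t := by
    ext x
    rw [regTest_apply_swap, convolution_def]
    simp [mul_comm]
  have h := (hasCompactSupport_mollifier (N := N) t).hasFDerivAt_convolution_right
    (ContinuousLinearMap.lsmul ℝ ℝ) hb ha1 z
  rw [regTest_lineDeriv, FunLike.coe_smul, Pi.smul_apply, smul_eq_mul,
    lineDeriv_testFunction_apply, hcomm, h.fderiv, convolution_precompR_apply _ hb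
      ((hasCompactSupport_mollifier t).fderiv ℝ) (ha1.continuous_fderiv (by simp)),
    convolution_lsmul_swap, abs_mul, abs_of_pos ht, mul_assoc]
  gcongr
  refine (norm_integral_le_integral_norm
    fun s => dilate t φ (z - s) • fderiv ℝ (mollifier (N := N) t) s e).trans ?_
  rw [mul_assoc, ← integral_mul_const]
  calc ∫ s, ‖dilate t φ (z - s) • fderiv ℝ (mollifier (N := N) t) s e‖
      ≤ ∫ s, |fderiv ℝ (mollifier (N := N) t) s e| * (((t : ℝ) ^ N)⁻¹ * M) := by
        refine integral_mono_of_nonneg (Eventually.of_forall fun _ => norm_nonneg _)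
          (hai.abs.mul_const _) (Eventually.of_forall fun s => ?_)
        simp only [norm_smul, Real.norm_eq_abs]
        rw [mul_comm]
        gcongr
        exact abs_dilate_le t hφ _
    _ = _ := rfl

variable {ι : Type} [Fintype ι]

/-- The components are treated as one vector field: an average of vectors is no longer than the
longest of them. This gives the sharp factor `t ^ (-N)`, which tends to one, without a loss from the
number of components. -/
lemma sum_sq_regTest_le {Φ : ι → 𝓓(cube N, ℝ)} (hΦ : IsUnitTest Φ) (z : Rn N) :
    ∑ i, regTest t (Φ i) z ^ 2 ≤ (((t : ℝ) ^ N)⁻¹) ^ 2 := by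
  have htN := coe_pow_pos (N := N) t
  let F : Rn N → EuclideanSpace ℝ ι := fun w => WithLp.toLp 2 fun i => dilate t (Φ i) w
  have hF : Continuous F := by
    refine (PiLp.continuous_toLp 2 _).comp (continuous_pi fun i => ?_)
    exact (contDiff_dilate t (Φ i)).continuous
  have hFn : ∀ w, ‖F w‖ ≤ ((t : ℝ) ^ N)⁻¹ := fun w => by
    rw [EuclideanSpace.norm_eq]
    refine Real.sqrt_le_iff.2 ⟨by positivity, ?_⟩
    simp only [F, dilate, Real.norm_eq_abs, sq_abs, mul_pow]
    rw [← Finset.mul_sum]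
    exact mul_le_of_le_one_right (by positivity) (hΦ _)
  have hint : Integrable fun s => mollifier t s • F (z - s) :=
    (integrable_mollifier t).smul_bdd _ (hF.comp (continuous_const.sub continuous_id)
      ).aestronglyMeasurable (Eventually.of_forall fun s => hFn _)
  have h1 : ∀ i, (∫ s, mollifier t s • F (z - s)) i = regTest t (Φ i) z := fun i => by
    rw [regTest_apply]
    exact ((EuclideanSpace.proj (𝕜 := ℝ) i).integral_comp_comm hint).symm
  have h2 : ‖∫ s, mollifier t s • F (z - s)‖ ≤ ((t : ℝ) ^ N)⁻¹ := by
    refine (norm_integral_le_integral_norm _).trans ?_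
    calc ∫ s, ‖mollifier t s • F (z - s)‖ ≤ ∫ s : Rn N, mollifier t s * ((t : ℝ) ^ N)⁻¹ := by
          refine integral_mono hint.norm ((integrable_mollifier t).mul_const _) fun s => ?_
          simp only [norm_smul, Real.norm_eq_abs, abs_of_nonneg (mollifier_nonneg t s)]
          exact mul_le_mul_of_nonneg_left (hFn _) (mollifier_nonneg t s)
      _ = ((t : ℝ) ^ N)⁻¹ := by rw [integral_mul_const, integral_mollifier, one_mul]
  calc ∑ i, regTest t (Φ i) z ^ 2 = ‖∫ s, mollifier t s • F (z - s)‖ ^ 2 := by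
        rw [EuclideanSpace.norm_sq_eq]
        simp [← h1]
    _ ≤ _ := pow_le_pow_left₀ (norm_nonneg _) h2 2

end Regularization

/-! ### Regularization of integrable functions and its adjoint -/

section Regularization

open scoped Convolution ContDiff

variable {N : ℕ} {V : Type} [NormedAddCommGroup V] [NormedSpace ℝ V]
  (t : Set.Ioo (0 : ℝ) 1)

/-- The function `x ↦ (a ⋆ f)(t x)`, with the mollifier `a` which belongs to `t`. -/
def regFun (f : Rn N → V) (x : Rn N) : V :=
  (mollifier t ⋆[ContinuousLinearMap.lsmul ℝ ℝ, volume] f) ((t : ℝ) • x)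

lemma integrable_regFun {f : Rn N → V} (hf : Integrable f) : Integrable (regFun t f) :=
  ((integrable_mollifier t).integrable_convolution _ hf).comp_smul (coe_pos t).ne'

lemma regFun_sub {f g : Rn N → V} (hf : Integrable f) (hg : Integrable g) :
    regFun t (f - g) =ᵐ[volume] regFun t f - regFun t g := by
  have h : ∀ {f : Rn N → V}, Integrable f → ∀ᵐ x : Rn N,
      Integrable fun s => mollifier t s • f (x - s) := fun {f} hf =>
    ((integrable_mollifier t).convolution_integrand (ContinuousLinearMap.lsmul ℝ ℝ) hf
      ).prod_right_ae
  -- The convolution integrals exist only almost everywhere, and the dilation must pull null sets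
  -- back to null sets.
  have hq : Measure.QuasiMeasurePreserving (fun x : Rn N => (t : ℝ) • x) volume volume := by
    refine ⟨measurable_const_smul _, ?_⟩
    rw [Measure.map_addHaar_smul _ (coe_pos t).ne']
    exact Measure.AbsolutelyContinuous.smul_left Measure.AbsolutelyContinuous.rfl _
  filter_upwards [hq.ae (h hf), hq.ae (h hg)] with x hfx hgx
  simp only [regFun, Pi.sub_apply, convolution_def, ContinuousLinearMap.lsmul_apply]
  rw [← integral_sub hfx hgx]
  simp [smul_sub]

/-- Convolution with a probability density does not increase the L¹ norm; the factor is the Jacobian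
of `x ↦ t x`. -/
lemma integral_norm_regFun_le {f : Rn N → V} (hf : Integrable f) :
    ∫ x, ‖regFun t f x‖ ≤ ((t : ℝ) ^ N)⁻¹ * ∫ x, ‖f x‖ := by
  have htN := coe_pow_pos (N := N) t
  have h1 := Measure.integral_comp_smul (volume : Measure (Rn N))
    (fun w => ‖(mollifier t ⋆[ContinuousLinearMap.lsmul ℝ ℝ, volume] f) w‖) (t : ℝ)
  rw [finrank_euclideanSpace_fin, abs_of_pos (by positivity), smul_eq_mul] at h1
  refine h1.le.trans (mul_le_mul_of_nonneg_left ?_ (by positivity))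
  have h2 := integral_convolution (ContinuousLinearMap.lsmul ℝ ℝ)
    (integrable_mollifier (N := N) t) hf.norm
  rw [integral_mollifier, ContinuousLinearMap.lsmul_apply, one_smul] at h2
  rw [← h2]
  refine integral_mono ((integrable_mollifier t).integrable_convolution _ hf).norm
    ((integrable_mollifier t).integrable_convolution _ hf.norm) fun x => ?_
  refine (norm_integral_le_integral_norm _).trans_eq ?_
  simp only [convolution_def, ContinuousLinearMap.lsmul_apply, norm_smul, Real.norm_eq_abs,
    abs_of_nonneg (mollifier_nonneg t _), smul_eq_mul]

/-- One `ε` for averaging near `t x` over a ball of radius `(1 - t) / 4`, another for moving from `t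
x` to `x`, a distance of at most `(1 - t) N` on the cube. -/
lemma norm_regFun_sub_le [CompleteSpace V] {g : Rn N → V} (hg : Continuous g) {ε δ : ℝ}
    (hδ : ∀ x y : Rn N, dist x y < δ → dist (g x) (g y) ≤ ε) (ht : 1 - (t : ℝ) < δ)
    (htN : (1 - t) * (N : ℝ) < δ) {x : Rn N} (hx : x ∈ (cube N : Set (Rn N))) :
    ‖regFun t g x - g x‖ ≤ 2 * ε := by
  have ht1 := t.2.2
  have h1 : dist (regFun t g x) (g ((t : ℝ) • x)) ≤ ε := by
    refine (mollifierBump t).dist_normed_convolution_le hg.aestronglyMeasurable fun y hy => ?_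
    refine hδ _ _ ((Metric.mem_ball.1 hy).trans ?_)
    change (1 - (t : ℝ)) / 4 < δ
    linarith
  have h2 : dist (g ((t : ℝ) • x)) (g x) ≤ ε := by
    refine hδ _ _ (lt_of_le_of_lt ?_ htN)
    rw [dist_eq_norm, show (t : ℝ) • x - x = -((1 - (t : ℝ)) • x) by module, norm_neg, norm_smul,
      Real.norm_eq_abs, abs_of_pos (by linarith)]
    exact mul_le_mul_of_nonneg_left (norm_le_of_mem_cube hx) (by linarith)
  rw [← dist_eq_norm]
  linarith [dist_triangle (regFun t g x) (g ((t : ℝ) • x)) (g x)]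

/-- The extension by zero. -/
def zeroExt (v : L1 N V) : Rn N → V := (cube N : Set (Rn N)).indicator v

lemma integrable_zeroExt {V : Type} [NormedAddCommGroup V] (v : L1 N V) : Integrable (zeroExt v) :=
  (integrable_indicator_iff (cube N).isOpen.measurableSet).2 (L1.integrable_coeFn v)

/-- The regularization of an integrable function by dilation and convolution. -/
def reg (v : L1 N V) : L1 N V :=
  ((integrable_regFun t (integrable_zeroExt v)).integrableOn (s := cube N)).toL1 _

lemma reg_ae_eq (v : L1 N V) : reg t v =ᵐ[leb N] regFun t (zeroExt v) :=
  Integrable.coeFn_toL1 _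

lemma norm_reg_sub (v : L1 N V) :
    ‖reg t v - v‖ = ∫ x, ‖regFun t (zeroExt v) x - zeroExt v x‖ ∂leb N := by
  rw [MeasureTheory.L1.norm_eq_integral_norm]
  refine integral_congr_ae ?_
  filter_upwards [Lp.coeFn_sub (reg t v) v, reg_ae_eq t v,
    ae_restrict_mem (cube N).isOpen.measurableSet] with x h1 h2 h3
  rw [h1, Pi.sub_apply, h2, zeroExt, Set.indicator_of_mem h3]

lemma reg_zero : reg t (0 : L1 N V) = 0 := by
  have h0 : zeroExt (0 : L1 N V) =ᵐ[volume] 0 := by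
    rw [zeroExt]
    exact (indicator_ae_eq_zero_of_restrict_ae_eq_zero (cube N).isOpen.measurableSet
      (Lp.coeFn_zero V 1 (leb N)))
  have h1 : ∫ x, ‖regFun t (zeroExt (0 : L1 N V)) x‖ ≤ 0 := by
    refine (integral_norm_regFun_le t (integrable_zeroExt _)).trans_eq ?_
    rw [integral_congr_ae (g := fun _ => 0) (by filter_upwards [h0] with x hx; simp [hx])]
    simp
  have h2 : ‖reg t (0 : L1 N V)‖ ≤ 0 := by
    rw [MeasureTheory.L1.norm_eq_integral_norm]
    refine le_trans ((integral_congr_ae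
      ((reg_ae_eq t (0 : L1 N V)).fun_comp norm)).trans_le ?_) h1
    exact setIntegral_le_integral (integrable_regFun t (integrable_zeroExt _)).norm
      (Eventually.of_forall fun _ => norm_nonneg _)
  simpa using h2

theorem tendsto_reg [CompleteSpace V] {t : ℕ → Set.Ioo (0 : ℝ) 1} (ht : Tendsto (fun n => (t n : ℝ)) atTop (𝓝 1))
    (v : L1 N V) : Tendsto (fun n => reg (t n) v) atTop (𝓝 v) := by
  rw [tendsto_iff_norm_sub_tendsto_zero, Metric.tendsto_atTop]
  intro ε hε
  -- Density argument: for `t` near one the regularization has norm at most 2 on L¹, so the errors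
  -- are `2 * (ε / 8)` and `ε / 8` from the approximation by `g`, and `ε / 4` from `g` itself.
  obtain ⟨g, hgc, hfg, hg, hgi⟩ :=
    (integrable_zeroExt v).exists_hasCompactSupport_integral_sub_le (show 0 < ε / 8 by positivity)
  set m : ℝ := (leb N).real Set.univ
  have hm : 0 ≤ m := measureReal_nonneg
  obtain ⟨δ, hδ, hgδ⟩ := Metric.uniformContinuous_iff.1
    (hgc.uniformContinuous_of_continuous hg) (ε / (8 * (m + 1))) (by positivity)
  have e1 : ∀ᶠ n in atTop, 1 - (t n : ℝ) < δ :=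
    (show Tendsto (fun n => 1 - (t n : ℝ)) atTop (𝓝 0) by simpa using ht.const_sub 1
      ).eventually_lt_const hδ
  have e2 : ∀ᶠ n in atTop, (1 - (t n : ℝ)) * N < δ :=
    (show Tendsto (fun n => (1 - (t n : ℝ)) * N) atTop (𝓝 0) by
      simpa using (ht.const_sub 1).mul_const (N : ℝ)).eventually_lt_const hδ
  have e3 : ∀ᶠ n in atTop, ((t n : ℝ) ^ N)⁻¹ < 2 :=
    (show Tendsto (fun n => ((t n : ℝ) ^ N)⁻¹) atTop (𝓝 1) by
      simpa using (ht.pow N).inv₀ (by simp)).eventually_lt_const one_lt_two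
  rw [← eventually_atTop]
  filter_upwards [e1, e2, e3] with n h1 h2 h3
  rw [Real.dist_eq, sub_zero, abs_of_nonneg (norm_nonneg _), norm_reg_sub]
  have i1 : Integrable (fun x => regFun (t n) (zeroExt v - g) x) :=
    integrable_regFun _ ((integrable_zeroExt v).sub hgi)
  have i2 : Integrable (fun x => zeroExt v x - g x) := (integrable_zeroExt v).sub hgi
  have i3 : Integrable (fun x => regFun (t n) g x - g x) := (integrable_regFun _ hgi).sub hgi
  have i4 : Integrable (fun x => ‖regFun (t n) g x - g x‖ + ‖zeroExt v x - g x‖) :=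
    i3.norm.add i2.norm
  have key : ∫ x, ‖regFun (t n) (zeroExt v) x - zeroExt v x‖ ∂leb N ≤
      (∫ x, ‖regFun (t n) (zeroExt v - g) x‖ ∂leb N) +
        ((∫ x, ‖regFun (t n) g x - g x‖ ∂leb N) + ∫ x, ‖zeroExt v x - g x‖ ∂leb N) := by
    rw [← integral_add i3.norm.integrableOn i2.norm.integrableOn,
      ← integral_add i1.norm.integrableOn i4.integrableOn]
    refine integral_mono_ae ((integrable_regFun _ (integrable_zeroExt v)).sub
      (integrable_zeroExt v)).norm.integrableOn
      (i1.norm.add i4).integrableOn ?_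
    filter_upwards [ae_restrict_of_ae (regFun_sub (t n) (integrable_zeroExt v) hgi)] with x hx
    simp only [hx, Pi.sub_apply]
    have e : regFun (t n) (zeroExt v) x - zeroExt v x =
        (regFun (t n) (zeroExt v) x - regFun (t n) g x) + ((regFun (t n) g x - g x) -
          (zeroExt v x - g x)) := by abel
    rw [e]
    exact (norm_add_le _ _).trans (add_le_add_right (norm_sub_le _ _) _)
  have k1 : ∫ x, ‖regFun (t n) (zeroExt v - g) x‖ ∂leb N ≤ 2 * (ε / 8) := by
    refine (setIntegral_le_integral i1.norm (Eventually.of_forall fun _ => norm_nonneg _)).trans ?_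
    refine (integral_norm_regFun_le _ ((integrable_zeroExt v).sub hgi)).trans ?_
    exact mul_le_mul h3.le hfg (integral_nonneg fun _ => norm_nonneg _) zero_le_two
  have k3 : ∫ x, ‖zeroExt v x - g x‖ ∂leb N ≤ ε / 8 :=
    (setIntegral_le_integral i2.norm (Eventually.of_forall fun _ => norm_nonneg _)).trans hfg
  have k2 : ∫ x, ‖regFun (t n) g x - g x‖ ∂leb N ≤ ε / 4 := by
    have : ∫ x, ‖regFun (t n) g x - g x‖ ∂leb N ≤
        ∫ _x, 2 * (ε / (8 * (m + 1))) ∂leb N := by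
      refine setIntegral_mono_on i3.norm.integrableOn (integrable_const _)
        (cube N).isOpen.measurableSet fun x hx => ?_
      exact norm_regFun_sub_le _ hg (fun x y hxy => (hgδ hxy).le) h1 h2 hx
    refine this.trans ?_
    rw [integral_const, smul_eq_mul]
    calc m * (2 * (ε / (8 * (m + 1)))) = ε / 4 * (m / (m + 1)) := by field_simp; ring
      _ ≤ ε / 4 * 1 := by
        gcongr
        exact (div_le_one (by positivity)).2 (by linarith)
      _ = ε / 4 := mul_one _
  linarith

/-- The regularization of functions is dual to the regularization of test functions. -/
theorem toDistr_reg [CompleteSpace V] (v : L1 N V) (φ : 𝓓(cube N, ℝ)) :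
    toDistr (reg t v) φ = toDistr v (regTest t φ) := by
  have htN := coe_pow_pos (N := N) t
  have hv := integrable_zeroExt v
  have e1 : toDistr (reg t v) φ = ∫ x, φ x • regFun t (zeroExt v) x := by
    change ofFun _ _ = _
    rw [ofFun_apply, ← setIntegral_eq_integral_of_forall_compl_eq_zero (s := cube N)
      (f := fun x => φ x • regFun t (zeroExt v) x)]
    · refine integral_congr_ae ?_
      filter_upwards [reg_ae_eq t v] with x hx
      rw [hx]
    · intro x hx
      rw [testFunction_eq_zero φ hx, zero_smul]
  have e2 : toDistr v (regTest t φ) = ∫ x, regTest t φ x • zeroExt v x := by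
    change ofFun _ _ = _
    rw [ofFun_apply, ← setIntegral_eq_integral_of_forall_compl_eq_zero (s := cube N)
      (f := fun x => regTest t φ x • zeroExt v x)]
    · refine setIntegral_congr_fun (cube N).isOpen.measurableSet fun x hx => ?_
      simp only [zeroExt]
      rw [Set.indicator_of_mem hx]
    · intro x hx
      rw [zeroExt, Set.indicator_of_notMem hx, smul_zero]
  -- Change of variables `w = t x`; its Jacobian is the factor in `dilate`.
  have e3 : ∫ x, φ x • regFun t (zeroExt v) x = ∫ w, dilate t φ w •
      (mollifier t ⋆[ContinuousLinearMap.lsmul ℝ ℝ, volume] zeroExt v) w := by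
    have h := Measure.integral_comp_smul (volume : Measure (Rn N))
      (fun w => φ ((t : ℝ)⁻¹ • w) •
        (mollifier t ⋆[ContinuousLinearMap.lsmul ℝ ℝ, volume] zeroExt v) w) (t : ℝ)
    rw [finrank_euclideanSpace_fin, abs_of_pos (by positivity), ← integral_smul] at h
    simp only [smul_smul, inv_mul_cancel₀ (coe_pos t).ne', one_smul] at h
    exact h
  have hprod : Integrable (Function.uncurry fun w y : Rn N =>
      dilate t φ w • mollifier t (w - y) • zeroExt v y) (volume.prod volume) := by
    obtain ⟨C, hC⟩ := (hasCompactSupport_dilate t φ).exists_bound_of_continuous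
      (contDiff_dilate t φ).continuous
    exact (hv.convolution_integrand (ContinuousLinearMap.lsmul ℝ ℝ).flip
      (integrable_mollifier t)).bdd_smul C
      ((contDiff_dilate t φ).continuous.comp continuous_fst).aestronglyMeasurable
      (Eventually.of_forall fun p => hC p.1)
  rw [e1, e2, e3]
  calc ∫ w, dilate t φ w • (mollifier t ⋆[ContinuousLinearMap.lsmul ℝ ℝ, volume] zeroExt v) w
      = ∫ w, ∫ y, dilate t φ w • mollifier t (w - y) • zeroExt v y := by
        refine integral_congr_ae (Eventually.of_forall fun w => ?_)
        simp only
        rw [convolution_lsmul_swap, integral_smul]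
    _ = ∫ y, ∫ w, dilate t φ w • mollifier t (w - y) • zeroExt v y := integral_integral_swap hprod
    _ = ∫ y, regTest t φ y • zeroExt v y := by
        refine integral_congr_ae (Eventually.of_forall fun y => ?_)
        simp only
        rw [regTest_apply_swap, ← integral_smul_const]
        refine integral_congr_ae (Eventually.of_forall fun w => ?_)
        simp only
        -- The mollifier is even, so its convolution is self-adjoint.
        rw [smul_smul, ← mollifier_neg t (y - w), neg_sub, mul_comm]

end Regularization

/-! ### First order operators under limits and regularization -/

section Operators

variable {N l : ℕ}

lemma contract_apply (C : EuclideanSpace ℝ ((Fin (l + 1) → Fin N) × (Fin l → Fin N)))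
    (w : Tensor N l) (I : Fin (l + 1) → Fin N) : contract C w I = ∑ J, C (I, J) * w J := rfl

lemma continuous_contract : Continuous fun p : EuclideanSpace ℝ ((Fin (l + 1) → Fin N) ×
    (Fin l → Fin N)) × Tensor N l => contract p.1 p.2 := by
  change Continuous fun p : EuclideanSpace ℝ ((Fin (l + 1) → Fin N) × (Fin l → Fin N)) ×
    Tensor N l => WithLp.toLp 2 fun I => ∑ J, p.1 (I, J) * p.2 J
  refine (PiLp.continuous_toLp 2 _).comp (continuous_pi fun I => ?_)
  exact continuous_finsetSum _ fun J _ => by fun_prop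

lemma contract_sub (C D : EuclideanSpace ℝ ((Fin (l + 1) → Fin N) × (Fin l → Fin N)))
    (w : Tensor N l) : contract (C - D) w = contract C w - contract D w := by
  ext I
  simp [contract_apply, sub_mul, Finset.sum_sub_distrib]

lemma norm_contract_le (C : EuclideanSpace ℝ ((Fin (l + 1) → Fin N) × (Fin l → Fin N)))
    (w : Tensor N l) : ‖contract C w‖ ≤ ‖C‖ * ‖w‖ := by
  rw [EuclideanSpace.norm_eq]
  refine Real.sqrt_le_iff.2 ⟨by positivity, ?_⟩
  rw [mul_pow, EuclideanSpace.norm_sq_eq, EuclideanSpace.norm_sq_eq, Fintype.sum_prod_type,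
    Finset.sum_mul]
  refine Finset.sum_le_sum fun I _ => ?_
  simp only [Real.norm_eq_abs, sq_abs, contract_apply]
  exact Finset.sum_mul_sq_le_sq_mul_sq _ _ _

lemma norm_toDistr_le {V : Type} [NormedAddCommGroup V] [NormedSpace ℝ V] (v : L1 N V)
    {φ : 𝓓(cube N, ℝ)} {M : ℝ} (hφ : ∀ x, |φ x| ≤ M) : ‖toDistr v φ‖ ≤ M * ‖v‖ := by
  change ‖ofFun v φ‖ ≤ _
  rw [ofFun_apply, MeasureTheory.L1.norm_eq_integral_norm, ← integral_const_mul]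
  refine norm_integral_le_of_norm_le ((L1.integrable_coeFn v).norm.const_mul _)
    (Eventually.of_forall fun x => ?_)
  rw [norm_smul]
  exact mul_le_mul_of_nonneg_right (hφ x) (norm_nonneg _)

lemma tendsto_toDistr {V : Type} [NormedAddCommGroup V] [NormedSpace ℝ V] {α : Type*}
    {f : Filter α} {v : α → L1 N V} {v' : L1 N V} (hv : Tendsto v f (𝓝 v')) (φ : 𝓓(cube N, ℝ)) :
    Tendsto (fun n => toDistr (v n) φ) f (𝓝 (toDistr v' φ)) := by
  rw [tendsto_iff_norm_sub_tendsto_zero] at hv ⊢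
  refine squeeze_zero (fun _ => norm_nonneg _) (fun n => ?_)
    (by simpa using hv.const_mul ‖restrictTest φ‖)
  have := norm_toDistr_le (v n - v') (abs_testFunction_le φ)
  rwa [map_sub] at this

lemma diffOp_apply (B : Op N l) (v : L1 N (Tensor N l)) (φ : 𝓓(cube N, ℝ)) :
    diffOp B v φ = -∑ i, contract (B i) (toDistr v (∂_{EuclideanSpace.single i (1 : ℝ)} φ)) := by
  change (∑ i : Fin N, Distribution.mapCLM (contract (B i))
    (∂_{EuclideanSpace.single i (1 : ℝ)} (toDistr v))) φ = _
  rw [← Finset.sum_neg_distrib]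
  simp [Distribution.mapCLM_apply, Distribution.lineDerivOp_apply_apply]

lemma grad_apply (u : L1 N ℝ) (φ : 𝓓(cube N, ℝ)) :
    grad u φ = -∑ i, toDistr u (∂_{EuclideanSpace.single i (1 : ℝ)} φ) •
      (EuclideanSpace.single (fun _ : Fin 1 => i) (1 : ℝ) : Tensor N 1) := by
  rw [grad, ← Finset.sum_neg_distrib]
  simp [Distribution.mapCLM_apply, Distribution.lineDerivOp_apply_apply]

lemma grad_smul (c : ℝ) (u : L1 N ℝ) : grad (c • u) = c • grad u := by
  ext1 φ
  change grad (c • u) φ = c • grad u φ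
  simp only [grad_apply, map_smul, smul_neg, Finset.smul_sum, smul_smul]
  rfl

lemma grad_add (u w : L1 N ℝ) : grad (u + w) = grad u + grad w := by
  ext1 φ
  change grad (u + w) φ = grad u φ + grad w φ
  simp only [grad_apply, map_add]
  rw [← neg_add, ← Finset.sum_add_distrib]
  simp only [← add_smul]
  rfl

lemma grad_zero : grad (0 : L1 N ℝ) = 0 := by
  ext1 φ
  change grad (0 : L1 N ℝ) φ = 0
  rw [grad_apply, map_zero]
  exact neg_eq_zero.2 (Finset.sum_eq_zero fun i _ => zero_smul ℝ _)

lemma tendsto_grad {α : Type*} {f : Filter α} {u : α → L1 N ℝ} {u' : L1 N ℝ}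
    (hu : ∀ φ, Tendsto (fun n => toDistr (u n) φ) f (𝓝 (toDistr u' φ))) (φ : 𝓓(cube N, ℝ)) :
    Tendsto (fun n => grad (u n) φ) f (𝓝 (grad u' φ)) := by
  simp only [grad_apply]
  exact (tendsto_finsetSum _ fun i _ => (hu _).smul_const _).neg

/-- The derivatives rest on the fixed test function, so L¹ convergence and convergence of the
coefficients suffice; no bound on the masses is involved. -/
lemma tendsto_diffOp {α : Type*} {f : Filter α} {B : α → Op N l} {B' : Op N l}
    (hB : Tendsto B f (𝓝 B')) {v : α → L1 N (Tensor N l)} {v' : L1 N (Tensor N l)}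
    (hv : Tendsto v f (𝓝 v')) (φ : 𝓓(cube N, ℝ)) :
    Tendsto (fun n => diffOp (B n) (v n) φ) f (𝓝 (diffOp B' v' φ)) := by
  simp only [diffOp_apply]
  refine (tendsto_finsetSum _ fun i _ => ?_).neg
  have h1 : Tendsto (fun n => B n i) f (𝓝 (B' i)) :=
    ((PiLp.continuous_apply 1 _ i).tendsto _).comp hB
  have h2 := tendsto_toDistr hv (∂_{EuclideanSpace.single i (1 : ℝ)} φ)
  have h3 := h1.prodMk_nhds h2
  have h4 := (continuous_contract.tendsto
    (B' i, toDistr v' (∂_{EuclideanSpace.single i (1 : ℝ)} φ))).comp h3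
  exact h4

lemma diffOp_sub (B B' : Op N l) (v : L1 N (Tensor N l)) :
    diffOp (B - B') v = diffOp B v - diffOp B' v := by
  ext1 φ
  change diffOp (B - B') v φ = diffOp B v φ - diffOp B' v φ
  simp only [diffOp_apply, PiLp.sub_apply, contract_sub, Finset.sum_sub_distrib]
  abel

lemma norm_op_apply_le (B : Op N l) (i : Fin N) : ‖B i‖ ≤ ‖B‖ := PiLp.norm_apply_le B i

/-! ### Regularization and operators -/

variable (t : Set.Ioo (0 : ℝ) 1)

lemma diffOp_reg (B : Op N l) (v : L1 N (Tensor N l)) (φ : 𝓓(cube N, ℝ)) :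
    diffOp B (reg t v) φ = (t : ℝ) • diffOp B v (regTest t φ) := by
  simp only [diffOp_apply, toDistr_reg, regTest_lineDeriv, map_smul, smul_neg, Finset.smul_sum]

/-- The derivative acquires a factor `t` that `w` does not, so the difference is dual to `w - t B v
= t (w - B v) + (1 - t) w`, tested with fields of size at most `t ^ (-N)`. -/
lemma mass_reg_sub_le (B : Op N l) (v : L1 N (Tensor N l)) (w : L1 N (Tensor N (l + 1))) :
    mass (toDistr (reg t w) - diffOp B (reg t v)) ≤ ENNReal.ofReal ((t : ℝ) ^ N)⁻¹ *
      (mass (toDistr w - diffOp B v) + ENNReal.ofReal (1 - t) * ‖w‖ₑ) := by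
  have ht := coe_pos t
  have ht1 : 0 ≤ 1 - (t : ℝ) := by have := t.2.2; linarith
  have htN := coe_pow_pos (N := N) t
  have h : mass (toDistr w - (t : ℝ) • diffOp B v) ≤
      mass (toDistr w - diffOp B v) + ENNReal.ofReal (1 - t) * ‖w‖ₑ := by
    have e : toDistr w - (t : ℝ) • diffOp B v =
        (t : ℝ) • (toDistr w - diffOp B v) + (1 - (t : ℝ)) • toDistr w := by module
    rw [e]
    refine (mass_add_le _ _).trans (add_le_add ?_ ?_)
    · refine (mass_smul_le _ _).trans ?_
      refine mul_le_of_le_one_left' (ENNReal.ofReal_le_one.2 ?_)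
      rw [abs_of_pos ht]
      exact t.2.2.le
    · refine (mass_smul_le _ _).trans ?_
      rw [abs_of_nonneg ht1]
      gcongr
      exact mass_toDistr_le w
  refine mass_le_iff.2 fun Φ hΦ => ?_
  have e : pairing (toDistr (reg t w) - diffOp B (reg t v)) Φ =
      pairing (toDistr w - (t : ℝ) • diffOp B v) fun i => regTest t (Φ i) := by
    refine Finset.sum_congr rfl fun i _ => ?_
    change (toDistr (reg t w) (Φ i) - diffOp B (reg t v) (Φ i)) i = _
    rw [toDistr_reg, diffOp_reg]
    rfl
  rw [e]
  refine (ofReal_pairing_le (by positivity) (sum_sq_regTest_le t hΦ)).trans ?_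
  gcongr

variable (N l) in
-- All derivatives can be placed on the mollifier. So a regularized function lies in `BVB B` for
-- every `B` at once, and `K`, which depends on `t`, serves all operators.
lemma exists_mass_diffOp_reg_le : ∃ K : ℝ, 0 ≤ K ∧ ∀ (B : Op N l) (v : L1 N (Tensor N l)),
    mass (diffOp B (reg t v)) ≤ ENNReal.ofReal (K * ‖B‖ * ‖v‖) := by
  choose C hC0 hC using fun i : Fin N =>
    exists_abs_regTest_lineDeriv_le t (EuclideanSpace.single i (1 : ℝ))
  have hCs : 0 ≤ ∑ i, C i := Finset.sum_nonneg fun i _ => hC0 i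
  refine ⟨Fintype.card (Fin (l + 1) → Fin N) * ∑ i, C i, by positivity,
    fun B v => mass_le_iff.2 fun Φ hΦ => ENNReal.ofReal_le_ofReal ?_⟩
  have h1 : ∀ I x, |Φ I x| ≤ 1 := fun I x => by
    rw [← sq_le_one_iff_abs_le_one]
    exact (Finset.single_le_sum (f := fun I => Φ I x ^ 2) (fun _ _ => sq_nonneg _)
      (Finset.mem_univ I)).trans (hΦ x)
  have h2 : ∀ I, ‖diffOp B (reg t v) (Φ I)‖ ≤ (∑ i, C i) * ‖B‖ * ‖v‖ := fun I => by
    rw [diffOp_apply, norm_neg, Finset.sum_mul, Finset.sum_mul]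
    refine (norm_sum_le _ _).trans (Finset.sum_le_sum fun i _ => ?_)
    refine (norm_contract_le _ _).trans ?_
    rw [toDistr_reg]
    have := norm_toDistr_le v (hC i (Φ I) 1 (h1 I))
    rw [mul_one] at this
    calc ‖B i‖ * ‖toDistr v (regTest t (∂_{EuclideanSpace.single i (1 : ℝ)} (Φ I)))‖
        ≤ ‖B‖ * (C i * ‖v‖) :=
          mul_le_mul (norm_op_apply_le B i) this (norm_nonneg _) (norm_nonneg _)
      _ = C i * ‖B‖ * ‖v‖ := by ring
  calc pairing (diffOp B (reg t v)) Φ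
      ≤ ∑ _I : Fin (l + 1) → Fin N, (∑ i, C i) * ‖B‖ * ‖v‖ :=
        Finset.sum_le_sum fun I _ => ((le_abs_self _).trans
          (PiLp.norm_apply_le (diffOp B (reg t v) (Φ I)) I)).trans (h2 I)
    _ = _ := by
      rw [Finset.sum_const, Finset.card_univ, nsmul_eq_mul]
      ring

/-! ### Injectivity -/

lemma eq_zero_of_mass_eq_zero {ι : Type} [Fintype ι] {T : 𝓓'(cube N, EuclideanSpace ℝ ι)}
    (hT : mass T = 0) : T = 0 := by
  classical
  have h : ∀ φ i, T φ i ≤ 0 := fun φ i => by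
    have := ofReal_pairing_le (T := T) (Φ := Pi.single i φ) (norm_nonneg (restrictTest φ))
      fun x => by
        rw [Finset.sum_eq_single i]
        · simpa using sq_le_sq' (abs_le.1 (abs_testFunction_le φ x)).1
            (abs_le.1 (abs_testFunction_le φ x)).2
        · intro j _ hj
          simp [hj]
        · simp
    rw [hT, mul_zero, pairing_single, nonpos_iff_eq_zero, ENNReal.ofReal_eq_zero] at this
    exact this
  ext φ i
  have h1 := h φ i
  have h2 := h (-φ) i
  rw [map_neg, PiLp.neg_apply] at h2
  exact le_antisymm h1 (neg_nonpos.1 h2)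

/-- The fundamental lemma of the calculus of variations. -/
lemma toDistr_injective {V : Type} [NormedAddCommGroup V] [NormedSpace ℝ V] [CompleteSpace V] :
    Function.Injective (toDistr : L1 N V →ₗ[ℝ] 𝓓'(cube N, V)) := by
  rw [← LinearMap.ker_eq_bot, LinearMap.ker_eq_bot']
  intro v hv
  have h := (cube N).isOpen.ae_eq_zero_of_integral_contDiff_smul_eq_zero (μ := leb N)
    ((L1.integrable_coeFn v).locallyIntegrable.locallyIntegrableOn _) fun g hg hgc hgs => by
      have := ofFun_apply v ⟨g, hg, hgc, hgs⟩
      rw [show ofFun v = 0 from hv] at this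
      exact this.symm
  refine Lp.ext ?_
  filter_upwards [h, ae_restrict_mem (cube N).isOpen.measurableSet, Lp.coeFn_zero V 1 (leb N)]
    with x h1 h2 h3
  rw [h3, h1 h2, Pi.zero_apply]

end Operators

/-! ### The energy of auxiliary functions and the seminorm -/

section Energy

variable {N k : ℕ}

/-- The total variations which enter the energy of `u` and its auxiliary functions `v`. -/
def defect (B : OpTuple N k) (u : L1 N ℝ) (v : (l : ℕ) → L1 N (Tensor N (l + 1))) :
    Fin (k + 1) → ℝ≥0∞ :=
  Fin.cons (mass (grad u - toDistr (v 0)))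
    fun l : Fin k => mass (toDistr (v (l + 1)) - diffOp (B l) (v l))

/-- The energy whose infimum is `pgv`. -/
def energy (α : Fin (k + 1) → ℝ) (B : OpTuple N k) (u : L1 N ℝ)
    (v : (l : ℕ) → L1 N (Tensor N (l + 1))) : ℝ≥0∞ :=
  ∑ i, ENNReal.ofReal (α i) * defect B u v i

variable {α : Fin (k + 1) → ℝ} {B : OpTuple N k} {u w : L1 N ℝ}
  {v z : (l : ℕ) → L1 N (Tensor N (l + 1))}

lemma defect_zero : defect B u v 0 = mass (grad u - toDistr (v 0)) := rfl

lemma defect_succ (l : Fin k) :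
    defect B u v l.succ = mass (toDistr (v (l + 1)) - diffOp (B l) (v l)) := rfl

lemma pgv_eq_iInf_energy : pgv α B u = ⨅ v ∈ competitors B, energy α B u v := by
  simp only [pgv, energy, Fin.sum_univ_succ, defect_zero, defect_succ]

lemma mass_smul_sub_smul_le {ι : Type} [Fintype ι] (T T' : 𝓓'(cube N, EuclideanSpace ℝ ι))
    (c : ℝ) : mass (c • T - c • T') ≤ ENNReal.ofReal |c| * mass (T - T') := by
  have e : c • T - c • T' = c • (T - T') := by module
  rw [e]
  exact mass_smul_le _ _

lemma mass_add_sub_add_le {ι : Type} [Fintype ι] (T T' U U' : 𝓓'(cube N, EuclideanSpace ℝ ι)) :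
    mass (T + U - (T' + U')) ≤ mass (T - T') + mass (U - U') := by
  rw [add_sub_add_comm]
  exact mass_add_le _ _

lemma defect_smul_le (c : ℝ) (i : Fin (k + 1)) :
    defect B (c • u) (c • v) i ≤ ENNReal.ofReal |c| * defect B u v i := by
  refine Fin.cases ?_ (fun l => ?_) i
  · simp only [defect_zero, Pi.smul_apply, grad_smul, map_smul]
    exact mass_smul_sub_smul_le _ _ _
  · simp only [defect_succ, Pi.smul_apply, map_smul]
    exact mass_smul_sub_smul_le _ _ _

lemma defect_add_le (i : Fin (k + 1)) :
    defect B (u + w) (v + z) i ≤ defect B u v i + defect B w z i := by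
  refine Fin.cases ?_ (fun l => ?_) i
  · simp only [defect_zero, Pi.add_apply, grad_add, map_add]
    exact mass_add_sub_add_le _ _ _ _
  · simp only [defect_succ, Pi.add_apply, map_add]
    exact mass_add_sub_add_le _ _ _ _

lemma energy_smul_le (c : ℝ) :
    energy α B (c • u) (c • v) ≤ ENNReal.ofReal |c| * energy α B u v := by
  rw [energy, energy, Finset.mul_sum]
  refine Finset.sum_le_sum fun i _ => ?_
  rw [mul_left_comm]
  gcongr
  exact defect_smul_le c i

lemma energy_add_le :
    energy α B (u + w) (v + z) ≤ energy α B u v + energy α B w z := by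
  rw [energy, energy, energy, ← Finset.sum_add_distrib]
  refine Finset.sum_le_sum fun i _ => ?_
  rw [← mul_add]
  gcongr
  exact defect_add_le i

/-- The total variation is lower semicontinuous along convergent data. -/
lemma defect_le_of_tendsto {β : Type*} {f : Filter β} [f.NeBot] {B' : β → OpTuple N k}
    {u' : β → L1 N ℝ} {v' : β → (l : ℕ) → L1 N (Tensor N (l + 1))}
    (hB : Tendsto B' f (𝓝 B)) (hu : ∀ φ, Tendsto (fun n => toDistr (u' n) φ) f (𝓝 (toDistr u φ)))
    (hv : ∀ l, Tendsto (fun n => v' n l) f (𝓝 (v l))) {c : Fin (k + 1) → ℝ≥0∞}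
    (hc : ∀ i, Tendsto (fun n => defect (B' n) (u' n) (v' n) i) f (𝓝 (c i))) (i : Fin (k + 1)) :
    defect B u v i ≤ c i := by
  refine Fin.cases ?_ (fun l => ?_) i
  · exact mass_le_of_tendsto (fun φ => (tendsto_grad hu φ).sub (tendsto_toDistr (hv 0) φ)) (hc 0)
  · exact mass_le_of_tendsto (fun φ => (tendsto_toDistr (hv _) φ).sub
      (tendsto_diffOp (tendsto_pi_nhds.1 hB l) (hv l) φ)) (hc l.succ)

lemma mass_le_enorm_add_mass_sub {ι : Type} [Fintype ι] (T : 𝓓'(cube N, EuclideanSpace ℝ ι))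
    (y : L1 N (EuclideanSpace ℝ ι)) : mass T ≤ ‖y‖ₑ + mass (toDistr y - T) := by
  have e : T = toDistr y - (toDistr y - T) := by abel
  conv_lhs => rw [e]
  exact (mass_sub_le _ _).trans (add_le_add_left (mass_toDistr_le _) _)

lemma mass_sub_comm {ι : Type} [Fintype ι] (T T' : 𝓓'(cube N, EuclideanSpace ℝ ι)) :
    mass (T - T') = mass (T' - T) := by
  rw [← mass_neg, neg_sub]

lemma mass_diffOp_le_defect (l : Fin k) :
    mass (diffOp (B l) (v l)) ≤ ‖v (l + 1)‖ₑ + defect B u v l.succ :=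
  mass_le_enorm_add_mass_sub _ _

lemma mass_grad_le_defect : mass (grad u) ≤ ‖v 0‖ₑ + defect B u v 0 := by
  rw [defect_zero, mass_sub_comm]
  exact mass_le_enorm_add_mass_sub (grad u) (v 0)

lemma mem_BV_iff : u ∈ BV N ↔ mass (grad u) ≠ ⊤ := by
  rw [BV, Set.mem_ofPred_eq]
  exact exists_isMeas_iff (grad u)

lemma mem_BVB_iff {l : ℕ} {A : Op N l} {y : L1 N (Tensor N l)} :
    y ∈ BVB A ↔ mass (diffOp A y) ≠ ⊤ := exists_isMeas_iff _

lemma energy_ne_top_iff (hα : ∀ i, 0 < α i) :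
    energy α B u v ≠ ⊤ ↔ ∀ i, defect B u v i ≠ ⊤ := by
  simp only [energy, ne_eq, ENNReal.sum_eq_top, Finset.mem_univ, true_and, not_exists]
  refine forall_congr' fun i => not_congr ?_
  rw [ENNReal.mul_eq_top]
  simp [hα i]

/-- Finite energy makes each defect finite, and `B v_l` differs from the L¹ function `v_{l+1}` by a
defect. Positivity of the weights matters, as `0 * ⊤ = 0`. -/
lemma mem_competitors_of_energy_ne_top (hα : ∀ i, 0 < α i) (hE : energy α B u v ≠ ⊤)
    (hv : ∀ l, k ≤ l → v l = 0) : v ∈ competitors B := by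
  refine ⟨fun l => mem_BVB_iff.2 (ne_top_of_le_ne_top ?_ (mass_diffOp_le_defect (u := u) l)), hv⟩
  exact ENNReal.add_ne_top.2 ⟨enorm_ne_top, (energy_ne_top_iff hα).1 hE _⟩

lemma mem_BV_of_energy_ne_top (hα : ∀ i, 0 < α i) (hE : energy α B u v ≠ ⊤) : u ∈ BV N := by
  refine mem_BV_iff.2 (ne_top_of_le_ne_top ?_ (mass_grad_le_defect (B := B) (v := v)))
  exact ENNReal.add_ne_top.2 ⟨enorm_ne_top, (energy_ne_top_iff hα).1 hE _⟩

/-- This removes the constraint `v_l ∈ BVB`, which varies with the operator: any tuple with zero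
tail may be used as a competitor. -/
lemma pgv_le_energy (hα : ∀ i, 0 < α i) (hv : ∀ l, k ≤ l → v l = 0) :
    pgv α B u ≤ energy α B u v := by
  by_cases hE : energy α B u v = ⊤
  · rw [hE]; exact le_top
  · rw [pgv_eq_iInf_energy]
    exact iInf₂_le v (mem_competitors_of_energy_ne_top hα hE hv)

lemma exists_energy_lt {c : ℝ≥0∞} (h : pgv α B u < c) :
    ∃ v, (∀ l, k ≤ l → v l = 0) ∧ energy α B u v < c := by
  rw [pgv_eq_iInf_energy] at h
  simp only [iInf_lt_iff] at h
  obtain ⟨v, hv, h⟩ := h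
  exact ⟨v, hv.2, h⟩

lemma pgv_ne_top (hα : ∀ i, 0 < α i) (hu : u ∈ BV N) : pgv α B u ≠ ⊤ := by
  refine ne_top_of_le_ne_top ((energy_ne_top_iff hα).2 fun i => ?_)
    (pgv_le_energy (v := 0) hα fun _ _ => rfl)
  refine Fin.cases ?_ (fun l => ?_) i
  · rw [defect_zero, Pi.zero_apply, map_zero, sub_zero]
    exact mem_BV_iff.1 hu
  · simp [defect_succ, mass_zero]

lemma pgv_zero (hα : ∀ i, 0 < α i) : pgv α B 0 = 0 := by
  refine le_antisymm ((pgv_le_energy (v := 0) hα fun _ _ => rfl).trans ?_) zero_le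
  refine (Finset.sum_eq_zero fun i _ => ?_).le
  refine mul_eq_zero_of_right _ ?_
  refine Fin.cases ?_ (fun l => ?_) i <;> simp [defect_zero, defect_succ, mass_zero, grad_zero]

lemma pgv_add_le (hα : ∀ i, 0 < α i) : pgv α B (u + w) ≤ pgv α B u + pgv α B w := by
  refine ENNReal.le_of_forall_pos_le_add fun ε hε h => ?_
  rw [ENNReal.add_lt_top] at h
  have hε2 : (ε / 2 : ℝ≥0∞) ≠ 0 := by simpa using hε.ne'
  obtain ⟨v, hv, h1⟩ := exists_energy_lt (ENNReal.lt_add_right h.1.ne hε2)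
  obtain ⟨z, hz, h2⟩ := exists_energy_lt (ENNReal.lt_add_right h.2.ne hε2)
  have h3 : pgv α B (u + w) ≤ energy α B (u + w) (v + z) :=
    pgv_le_energy hα fun l hl => by simp [hv l hl, hz l hl]
  refine h3.trans (energy_add_le.trans ((add_le_add h1.le h2.le).trans_eq ?_))
  rw [add_add_add_comm, ENNReal.add_halves]

lemma pgv_smul_le (hα : ∀ i, 0 < α i) {c : ℝ} (hc : 0 < c) :
    pgv α B (c • u) ≤ ENNReal.ofReal c * pgv α B u := by
  rw [pgv_eq_iInf_energy (u := u), ENNReal.mul_iInf_of_ne (by simpa using hc)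
    ENNReal.ofReal_ne_top]
  refine le_iInf fun v => ?_
  rw [ENNReal.mul_iInf_of_ne (by simpa using hc) ENNReal.ofReal_ne_top]
  refine le_iInf fun hv => ?_
  refine (pgv_le_energy (v := c • v) hα fun l hl => by simp [hv.2 l hl]).trans ?_
  simpa [abs_of_pos hc] using energy_smul_le (α := α) (B := B) (u := u) (v := v) c

/-! ### The upper bound for varying parameters -/

/-- Write `A = B + (A - B)`: the part with `B` is nearly the old defect, and `A - B` acts on a
regularized function. `u` is not regularized, which costs `‖reg t (v 0) - v 0‖` in the first defect.
`K` depends on `v` and `t`, but not on `A`. -/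
lemma defect_reg_le (t : Set.Ioo (0 : ℝ) 1) : ∃ K : ℝ≥0, ∀ (A : OpTuple N k) (i : Fin (k + 1)),
    defect A u (fun l => reg t (v l)) i ≤ ENNReal.ofReal ((t : ℝ) ^ N)⁻¹ * (defect B u v i +
      ENNReal.ofReal (1 - t) * ∑ l ∈ Finset.range (k + 1), ‖v l‖ₑ) + ‖reg t (v 0) - v 0‖ₑ +
        K * ‖A - B‖ₑ := by
  choose K hK0 hK using fun l : ℕ => exists_mass_diffOp_reg_le N (l + 1) t
  have htN := coe_pow_pos (N := N) t
  have ht1 : 1 ≤ ENNReal.ofReal ((t : ℝ) ^ N)⁻¹ := by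
    rw [ENNReal.one_le_ofReal]
    exact (one_le_inv₀ htN).2 (pow_le_one₀ (coe_pos t).le t.2.2.le)
  refine ⟨∑ l ∈ Finset.range k, (K l * ‖v l‖).toNNReal, fun A i => ?_⟩
  refine Fin.cases ?_ (fun l => ?_) i
  · refine le_add_right ?_
    have e : grad u - toDistr (reg t (v 0)) =
        (grad u - toDistr (v 0)) - toDistr (reg t (v 0) - v 0) := by
      rw [map_sub]; abel
    rw [defect_zero, e]
    refine (mass_sub_le _ _).trans (add_le_add ?_ (mass_toDistr_le _))
    refine le_mul_of_one_le_of_le ht1 ?_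
    exact le_add_right le_rfl
  · have e : toDistr (reg t (v (l + 1))) - diffOp (A l) (reg t (v l)) =
        (toDistr (reg t (v (l + 1))) - diffOp (B l) (reg t (v l))) -
          diffOp (A l - B l) (reg t (v l)) := by
      rw [diffOp_sub]; abel
    rw [defect_succ, e]
    refine (mass_sub_le _ _).trans (add_le_add (le_add_right ((mass_reg_sub_le t _ _ _).trans ?_))
      ((hK _ _ _).trans ?_))
    · gcongr
      · exact le_rfl
      exact Finset.single_le_sum (f := fun l => ‖v l‖ₑ) (fun _ _ => zero_le)
        (Finset.mem_range.2 (by have := l.2; omega))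
    · have h1 : ‖A l - B l‖ ≤ ‖A - B‖ := norm_le_pi_norm (A - B) l
      have h2 : (K l * ‖v l‖).toNNReal ≤ ∑ l ∈ Finset.range k, (K l * ‖v l‖).toNNReal :=
        Finset.single_le_sum (f := fun l => (K l * ‖v l‖).toNNReal) (fun _ _ => zero_le)
          (Finset.mem_range.2 l.2)
      calc ENNReal.ofReal (K l * ‖A l - B l‖ * ‖v l‖)
          ≤ ENNReal.ofReal (K l * ‖v l‖ * ‖A - B‖) := by
            refine ENNReal.ofReal_le_ofReal ?_
            rw [mul_right_comm]
            exact mul_le_mul_of_nonneg_left h1 (mul_nonneg (hK0 l) (norm_nonneg _))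
        _ = ((K l * ‖v l‖).toNNReal : ℝ≥0∞) * ‖A - B‖ₑ := by
            rw [ENNReal.ofReal_mul (mul_nonneg (hK0 l) (norm_nonneg _)), ofReal_norm]
            rfl
        _ ≤ _ := by gcongr

/-- The seminorm is upper semicontinuous in the parameters, for a fixed function. -/
theorem eventually_pgv_lt {β : Type*} {f : Filter β} {α' : β → Fin (k + 1) → ℝ}
    {B' : β → OpTuple N k} (hα : Tendsto α' f (𝓝 α)) (hB : Tendsto B' f (𝓝 B))
    (hα0 : ∀ i, 0 < α i) (hα' : ∀ n i, 0 < α' n i) {c : ℝ≥0∞} (hc : pgv α B w < c) :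
    ∀ᶠ n in f, pgv (α' n) (B' n) w < c := by
  obtain ⟨v, hv, hE⟩ := exists_energy_lt hc
  have hD := (energy_ne_top_iff hα0).1 hE.ne_top
  set s : ℝ≥0∞ := ∑ l ∈ Finset.range (k + 1), ‖v l‖ₑ
  have hs : s ≠ ⊤ := by simp [s, ENNReal.sum_eq_top]
  let F : Set.Ioo (0 : ℝ) 1 → Fin (k + 1) → ℝ≥0∞ := fun t i =>
    ENNReal.ofReal ((t : ℝ) ^ N)⁻¹ * (defect B w v i + ENNReal.ofReal (1 - t) * s) +
      ‖reg t (v 0) - v 0‖ₑ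
  -- The shift by 2 keeps the value in the open interval at `n = 0`.
  let τ : ℕ → Set.Ioo (0 : ℝ) 1 := fun n => ⟨1 - 1 / ((n : ℝ) + 2), by
    have h1 : 0 < 1 / ((n : ℝ) + 2) := by positivity
    have h2 : 1 / ((n : ℝ) + 2) < 1 := by
      rw [div_lt_one (by positivity)]
      have : (0 : ℝ) ≤ n := n.cast_nonneg
      linarith
    constructor <;> linarith⟩
  have hτ : Tendsto (fun n => (τ n : ℝ)) atTop (𝓝 1) := by
    have h : Tendsto (fun n : ℕ => 1 / ((n : ℝ) + 2)) atTop (𝓝 0) :=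
      tendsto_const_nhds.div_atTop
        (tendsto_atTop_add_const_right _ _ tendsto_natCast_atTop_atTop)
    simpa [τ] using h.const_sub 1
  have hF : ∀ i, Tendsto (fun n => F (τ n) i) atTop (𝓝 (defect B w v i)) := fun i => by
    have h1 : Tendsto (fun n => ENNReal.ofReal ((τ n : ℝ) ^ N)⁻¹) atTop (𝓝 1) := by
      simpa using ENNReal.tendsto_ofReal ((hτ.pow N).inv₀ (by simp))
    have h2 : Tendsto (fun n => ENNReal.ofReal (1 - τ n)) atTop (𝓝 0) := by
      simpa using ENNReal.tendsto_ofReal (hτ.const_sub 1)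
    have h3 : Tendsto (fun n => ‖reg (τ n) (v 0) - v 0‖ₑ) atTop (𝓝 0) := by
      simpa using ((tendsto_reg hτ (v 0)).sub_const (v 0)).enorm
    have h4 : Tendsto (fun n => defect B w v i + ENNReal.ofReal (1 - τ n) * s) atTop
        (𝓝 (defect B w v i)) := by
      simpa using tendsto_const_nhds.add (ENNReal.Tendsto.mul_const h2 (Or.inr hs))
    simpa using (ENNReal.Tendsto.mul h1 (Or.inl one_ne_zero) h4 (Or.inr ENNReal.one_ne_top)).add h3
  have hG : Tendsto (fun n => ∑ i, ENNReal.ofReal (α i) * F (τ n) i) atTop (𝓝 (energy α B w v)) :=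
    tendsto_finsetSum _ fun i _ => ENNReal.Tendsto.const_mul (hF i) (Or.inr ENNReal.ofReal_ne_top)
  -- The order matters: the dilation factor is fixed first, with energy still below `c`; only then
  -- do the parameters converge, because `K` may blow up as `t → 1`.
  obtain ⟨n, hn⟩ := (hG.eventually_lt_const hE).exists
  obtain ⟨K, hK⟩ := defect_reg_le (B := B) (u := w) (v := v) (τ n)
  have hH : Tendsto (fun m => ∑ i, ENNReal.ofReal (α' m i) * (F (τ n) i + K * ‖B' m - B‖ₑ)) f
      (𝓝 (∑ i, ENNReal.ofReal (α i) * F (τ n) i)) := by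
    refine tendsto_finsetSum _ fun i _ => ?_
    have h1 : Tendsto (fun m => ENNReal.ofReal (α' m i)) f (𝓝 (ENNReal.ofReal (α i))) :=
      ENNReal.tendsto_ofReal (tendsto_pi_nhds.1 hα i)
    have h2 : Tendsto (fun m => ‖B' m - B‖ₑ) f (𝓝 0) := by
      simpa using (hB.sub_const B).enorm
    have h3 : Tendsto (fun m => F (τ n) i + K * ‖B' m - B‖ₑ) f (𝓝 (F (τ n) i)) := by
      simpa using tendsto_const_nhds.add
        (ENNReal.Tendsto.const_mul h2 (Or.inr (ENNReal.coe_ne_top (r := K))))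
    exact ENNReal.Tendsto.mul h1 (Or.inl (by simpa using hα0 i)) h3
      (Or.inr ENNReal.ofReal_ne_top)
  filter_upwards [hH.eventually_lt_const hn] with m hm
  refine lt_of_le_of_lt ((pgv_le_energy (v := fun l => reg (τ n) (v l)) (hα' m)
    fun l hl => ?_).trans (Finset.sum_le_sum fun i _ => ?_)) hm
  · rw [hv l hl, reg_zero]
  · gcongr
    exact hK (B' m) i

end Energy

/-! ### Compactness of auxiliary functions and joint lower semicontinuity -/

section Compactness

variable {N k : ℕ} {S : Set (OpTuple N k)}

/-- Vanishing defects determine the chain from its start: v_0 = D0, then v_{l+1} = ℬ^l v_l. -/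
lemma eq_zero_of_defect_eq_zero {B : OpTuple N k} {v : (l : ℕ) → L1 N (Tensor N (l + 1))}
    (hv : ∀ l, k ≤ l → v l = 0) (hD : ∀ i, defect B 0 v i = 0) (l : ℕ) : v l = 0 := by
  induction l with
  | zero =>
    have h := eq_zero_of_mass_eq_zero (hD 0)
    rw [grad_zero] at h
    exact toDistr_injective ((sub_eq_zero.1 h).symm.trans (map_zero _).symm)
  | succ l ih =>
    by_cases hl : l < k
    · have h := eq_zero_of_mass_eq_zero (hD (Fin.succ ⟨l, hl⟩))
      rw [ih, map_zero, sub_zero] at h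
      exact toDistr_injective (h.trans (map_zero _).symm)
    · exact hv _ (by omega)

/-- Bounded auxiliary functions with bounded total variations have convergent subsequences. -/
lemma exists_subseq_tendsto (hS : IsTrainingSet S) {B : ℕ → OpTuple N k} (hB : ∀ n, B n ∈ S)
    {u : ℕ → L1 N ℝ} {v : ℕ → (l : ℕ) → L1 N (Tensor N (l + 1))}
    (hv : ∀ n l, k ≤ l → v n l = 0) {M : ℝ≥0} (hM : ∀ n l, ‖v n l‖ₑ ≤ M)
    (hD : ∀ n i, defect (B n) (u n) (v n) i ≤ M) :
    ∃ (j : ℕ → ℕ) (v' : (l : ℕ) → L1 N (Tensor N (l + 1))), StrictMono j ∧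
      ∀ l, Tendsto (fun n => v (j n) l) atTop (𝓝 (v' l)) := by
  obtain ⟨R, hR⟩ := isBounded_iff_forall_norm_le.1 hS.isBounded
  have key : ∀ m ≤ k, ∃ j : ℕ → ℕ, StrictMono j ∧ ∀ l < m, ∃ y,
      Tendsto (fun n => v (j n) l) atTop (𝓝 y) := by
    intro m
    induction m with
    | zero => exact fun _ => ⟨id, strictMono_id, fun l hl => absurd hl (Nat.not_lt_zero l)⟩
    | succ m ih =>
      intro hm
      obtain ⟨j, hj, hjv⟩ := ih (by omega)
      have hb : (⨆ n, (‖B (j n) ⟨m, hm⟩‖ₑ + bvbNorm (B (j n) ⟨m, hm⟩) (v (j n) m))) < ∞ := by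
        -- `R` bounds the operators, the first `M` the norm of `v_m`, and `M + M` the mass of ℬ v_m
        -- through `v_{m+1}` and the defect.
        have hlt : ENNReal.ofReal R + (M + (M + M)) < ∞ := by
          rw [ENNReal.add_lt_top]
          exact ⟨ENNReal.ofReal_lt_top, by exact_mod_cast ENNReal.coe_lt_top⟩
        refine lt_of_le_of_lt (iSup_le fun n => add_le_add ?_ (add_le_add (hM _ _) ?_)) hlt
        · rw [← ofReal_norm]
          exact ENNReal.ofReal_le_ofReal
            ((norm_le_pi_norm (B (j n)) ⟨m, hm⟩).trans (hR _ (hB _)))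
        · exact (mass_diffOp_le_defect (u := u (j n)) (⟨m, hm⟩ : Fin k)).trans
            (add_le_add (hM _ _) (hD _ _))
      -- Only the L¹ limit is kept; limits of the operators are obtained separately, from
      -- convergence of the coefficients.
      obtain ⟨B', y, i, -, hi, hy, -⟩ := hS.compactClosure ⟨m, hm⟩ (fun n => v (j n) m)
        (fun n => B (j n) ⟨m, hm⟩)
        (fun n => ⟨⟨B (j n), hB _, rfl⟩, (hS.subset_classPi _ (hB _) ⟨m, hm⟩).2⟩) hb
      refine ⟨j ∘ i, hj.comp hi, fun l hl => ?_⟩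
      rcases Nat.lt_succ_iff_lt_or_eq.1 hl with hl | rfl
      · obtain ⟨y, hy⟩ := hjv l hl
        exact ⟨y, hy.comp hi.tendsto_atTop⟩
      · exact ⟨y, hy⟩
  obtain ⟨j, hj, hjv⟩ := key k le_rfl
  have h : ∀ l, ∃ y, Tendsto (fun n => v (j n) l) atTop (𝓝 y) := fun l => by
    by_cases hl : l < k
    · exact hjv l hl
    · exact ⟨0, tendsto_const_nhds.congr fun n => (hv _ l (by omega)).symm⟩
  choose v' hv' using h
  exact ⟨j, v', hj, hv'⟩

lemma IsTrainingSet.isCompact (hS : IsTrainingSet S) : IsCompact S :=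
  Metric.isCompact_of_isClosed_isBounded hS.isClosed hS.isBounded

/-- The auxiliary functions are bounded by the function and the total variations. -/
lemma exists_enorm_le (hS : IsTrainingSet S) {B : ℕ → OpTuple N k} (hB : ∀ n, B n ∈ S)
    {u : ℕ → L1 N ℝ} {v : ℕ → (l : ℕ) → L1 N (Tensor N (l + 1))}
    (hv : ∀ n l, k ≤ l → v n l = 0) {C : ℝ≥0} (hu : ∀ n, ‖u n‖ ≤ C)
    (hD : ∀ n i, defect (B n) (u n) (v n) i ≤ C) : ∃ M : ℝ≥0, ∀ n l, ‖v n l‖ₑ ≤ M := by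
  let σ : ℕ → ℝ := fun n => ∑ l ∈ Finset.range k, ‖v n l‖
  have hσ : ∀ n l, ‖v n l‖ ≤ σ n := fun n l => by
    by_cases hl : l < k
    · exact Finset.single_le_sum (f := fun l => ‖v n l‖) (fun _ _ => norm_nonneg _)
        (Finset.mem_range.2 hl)
    · rw [hv n l (by omega), norm_zero]
      exact Finset.sum_nonneg fun _ _ => norm_nonneg _
  suffices h : ∃ R, ∀ n, σ n ≤ R by
    obtain ⟨R, hR⟩ := h
    refine ⟨R.toNNReal, fun n l => ?_⟩
    rw [← ofReal_norm]
    exact ENNReal.ofReal_le_ofReal ((hσ n l).trans (hR n))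
  by_contra! h
  -- Total norms above `m + 1`: after division by them, the functions `u` and all defects tend to
  -- zero while the tuples have total norm one.
  choose n hn using fun m : ℕ => h ((m : ℝ) + 1)
  have hpos : ∀ m, 0 < σ (n m) := fun m => lt_trans (by positivity) (hn m)
  have hc1 : ∀ m, (σ (n m))⁻¹ ≤ 1 / ((m : ℝ) + 1) := fun m => by
    rw [one_div]
    exact inv_anti₀ (by positivity) (hn m).le
  have hc0 : Tendsto (fun m => (σ (n m))⁻¹) atTop (𝓝 0) :=
    squeeze_zero (fun m => (inv_pos.2 (hpos m)).le) hc1 tendsto_one_div_add_atTop_nhds_zero_nat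
  have hc2 : ∀ m, (σ (n m))⁻¹ ≤ 1 := fun m => (hc1 m).trans (by
    rw [div_le_one (by positivity)]
    have : (0 : ℝ) ≤ m := m.cast_nonneg
    linarith)
  have hdef : ∀ m i, defect (B (n m)) ((σ (n m))⁻¹ • u (n m)) ((σ (n m))⁻¹ • v (n m)) i ≤
      ENNReal.ofReal (σ (n m))⁻¹ * C := fun m i => by
    refine (defect_smul_le _ i).trans ?_
    rw [abs_of_pos (inv_pos.2 (hpos m))]
    gcongr
    exact hD _ _
  obtain ⟨j, v', hj, hv'⟩ := exists_subseq_tendsto hS (fun m => hB (n m))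
    (u := fun m => (σ (n m))⁻¹ • u (n m)) (v := fun m => (σ (n m))⁻¹ • v (n m)) (M := 1 + C)
    (fun m l hl => by simp [hv _ l hl])
    (fun m l => by
      have h1 : ‖((σ (n m))⁻¹ • v (n m)) l‖ ≤ 1 := by
        rw [Pi.smul_apply, norm_smul, Real.norm_eq_abs, abs_of_pos (inv_pos.2 (hpos m)),
          inv_mul_le_one₀ (hpos m)]
        exact hσ _ _
      rw [← ofReal_norm]
      refine (ENNReal.ofReal_le_ofReal h1).trans ?_
      simp)
    (fun m i => (hdef m i).trans (by
      have h1 : ENNReal.ofReal (σ (n m))⁻¹ ≤ 1 := ENNReal.ofReal_le_one.2 (hc2 m)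
      calc ENNReal.ofReal (σ (n m))⁻¹ * C ≤ 1 * C := by gcongr
        _ ≤ _ := by simp))
  obtain ⟨B', -, i, hi, hB'⟩ := hS.isCompact.tendsto_subseq fun m => hB (n (j m))
  have hji : Tendsto (fun m => j (i m)) atTop atTop :=
    hj.tendsto_atTop.comp hi.tendsto_atTop
  have hzero : ∀ l, v' l = 0 := by
    refine eq_zero_of_defect_eq_zero (B := B') (fun l hl => ?_) fun q => ?_
    · refine tendsto_nhds_unique (hv' l) (tendsto_const_nhds.congr fun m => ?_)
      simp [hv _ l hl]
    · refine le_antisymm (defect_le_of_tendsto (c := 0) (f := atTop)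
        (u' := fun m => (σ (n (j (i m))))⁻¹ • u (n (j (i m))))
        (v' := fun m => (σ (n (j (i m))))⁻¹ • v (n (j (i m)))) hB' (fun φ => ?_)
        (fun l => (hv' l).comp hi.tendsto_atTop) (fun q => ?_) q) zero_le
      · refine tendsto_toDistr ?_ φ
        refine squeeze_zero_norm (fun m => ?_)
          (by simpa using (hc0.comp hji).mul_const (C : ℝ))
        rw [norm_smul, Real.norm_eq_abs, abs_of_pos (inv_pos.2 (hpos _))]
        exact mul_le_mul_of_nonneg_left (hu _) (inv_pos.2 (hpos _)).le
      · refine tendsto_of_tendsto_of_tendsto_of_le_of_le tendsto_const_nhds ?_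
          (fun _ => zero_le) (fun m => hdef (j (i m)) q)
        simpa using ENNReal.Tendsto.mul_const (ENNReal.tendsto_ofReal (hc0.comp hji))
          (Or.inr (ENNReal.coe_ne_top (r := C)))
  have h1 : Tendsto (fun m => ∑ l ∈ Finset.range k, ‖((σ (n (j m)))⁻¹ • v (n (j m))) l‖) atTop
      (𝓝 (∑ l ∈ Finset.range k, ‖v' l‖)) := tendsto_finsetSum _ fun l _ => (hv' l).norm
  -- Strong convergence preserves the total norm one, which contradicts the zero limit.
  have h2 : ∀ m, ∑ l ∈ Finset.range k, ‖((σ (n (j m)))⁻¹ • v (n (j m))) l‖ = 1 := fun m => by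
    simp only [Pi.smul_apply, norm_smul, Real.norm_eq_abs, abs_of_pos (inv_pos.2 (hpos (j m)))]
    rw [← Finset.mul_sum]
    exact inv_mul_cancel₀ (hpos (j m)).ne'
  have h3 := tendsto_nhds_unique h1 (tendsto_const_nhds.congr fun m => (h2 m).symm)
  simp [hzero] at h3

/-- The seminorm is lower semicontinuous, jointly in the function and the parameters. -/
theorem pgv_le_of_tendsto (hS : IsTrainingSet S) {θ : ℝ} (hθ : 0 < θ)
    {p : ℕ → (Fin (k + 1) → ℝ) × OpTuple N k} (hp : ∀ n, p n ∈ params θ S)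
    {p' : (Fin (k + 1) → ℝ) × OpTuple N k} (hpp : Tendsto p atTop (𝓝 p'))
    {u : ℕ → L1 N ℝ} {u' : L1 N ℝ} {C : ℝ≥0} (hu : ∀ n, ‖u n‖ ≤ C)
    (huu : ∀ φ, Tendsto (fun n => toDistr (u n) φ) atTop (𝓝 (toDistr u' φ)))
    {e : ℕ → ℝ≥0∞} {c : ℝ≥0∞} (he : ∀ n, pgv (p n).1 (p n).2 (u n) < e n) (heC : ∀ n, e n ≤ C)
    (hec : Tendsto e atTop (𝓝 c)) : u' ∈ BV N ∧ pgv p'.1 p'.2 u' ≤ c := by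
  -- Strict bounds `e n` provide nearly optimal auxiliary functions without requiring the infimum to
  -- be attained.
  choose v hv hE using fun n => exists_energy_lt (he n)
  have hα : Tendsto (fun n => (p n).1) atTop (𝓝 p'.1) := (continuous_fst.tendsto p').comp hpp
  have hB : Tendsto (fun n => (p n).2) atTop (𝓝 p'.2) := (continuous_snd.tendsto p').comp hpp
  have hα0 : ∀ i, 0 < p'.1 i := fun i =>
    hθ.trans_le (ge_of_tendsto' (tendsto_pi_nhds.1 hα i) fun n => ((hp n).1 i).1)
  have hcC : c ≤ C := le_of_tendsto' hec heC
  -- All weights are at least `θ`, so an energy bound `C` bounds each defect by `C / θ`.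
  set C₁ : ℝ≥0 := θ.toNNReal⁻¹ * C with hC₁
  have hD : ∀ n i, defect (p n).2 (u n) (v n) i ≤ C₁ := fun n i => by
    have hθ' : θ.toNNReal ≠ 0 := by simpa using hθ
    have h1 : ENNReal.ofReal θ * defect (p n).2 (u n) (v n) i ≤ C := by
      refine le_trans ?_ ((hE n).le.trans (heC n))
      refine le_trans ?_ (Finset.single_le_sum (f := fun i => ENNReal.ofReal ((p n).1 i) *
        defect (p n).2 (u n) (v n) i) (fun _ _ => zero_le) (Finset.mem_univ i))
      gcongr
      exact ((hp n).1 i).1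
    rw [hC₁, ENNReal.coe_mul, ENNReal.coe_inv hθ']
    exact (ENNReal.mul_le_iff_le_inv (by simpa using hθ') ENNReal.coe_ne_top).1 h1
  obtain ⟨M, hM⟩ := exists_enorm_le hS (fun n => (hp n).2) hv (C := C + C₁)
    (fun n => (hu n).trans (by simp)) fun n i => (hD n i).trans (by simp)
  obtain ⟨j, v', hj, hv'⟩ := exists_subseq_tendsto hS (fun n => (hp n).2) hv (M := M + C₁)
    (fun n l => (hM n l).trans (by simp)) fun n i => (hD n i).trans (by simp)
  obtain ⟨d, i, hi, hd⟩ := CompactSpace.tendsto_subseq fun n => defect (p (j n)).2 (u (j n)) (v (j n))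
  have hji : Tendsto (fun m => j (i m)) atTop atTop :=
    hj.tendsto_atTop.comp hi.tendsto_atTop
  have hd' := fun q => tendsto_pi_nhds.1 hd q
  have hdC : ∀ q, d q ≠ ⊤ := fun q =>
    ne_top_of_le_ne_top ENNReal.coe_ne_top (le_of_tendsto' (hd' q) fun n => hD _ q)
  have h1 : ∀ q, defect p'.2 u' v' q ≤ d q := fun q =>
    defect_le_of_tendsto (hB.comp hji) (fun φ => (huu φ).comp hji)
      (fun l => (hv' l).comp hi.tendsto_atTop) hd' q
  have h2 : Tendsto (fun n => energy (p (j (i n))).1 (p (j (i n))).2 (u (j (i n))) (v (j (i n))))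
      atTop (𝓝 (∑ q, ENNReal.ofReal (p'.1 q) * d q)) := by
    refine tendsto_finsetSum _ fun q _ => ?_
    have h3 : Tendsto (fun n => ENNReal.ofReal ((p (j (i n))).1 q)) atTop
        (𝓝 (ENNReal.ofReal (p'.1 q))) :=
      ENNReal.tendsto_ofReal ((tendsto_pi_nhds.1 hα q).comp hji)
    exact ENNReal.Tendsto.mul h3 (Or.inr (hdC q)) (hd' q) (Or.inr ENNReal.ofReal_ne_top)
  have h3 : energy p'.1 p'.2 u' v' ≤ c := by
    refine le_trans (Finset.sum_le_sum fun q _ => ?_)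
      (le_of_tendsto_of_tendsto' h2 (hec.comp hji) fun n => (hE _).le)
    gcongr
    exact h1 q
  refine ⟨mem_BV_of_energy_ne_top hα0 (ne_top_of_le_ne_top ENNReal.coe_ne_top (h3.trans hcC)),
    (pgv_le_energy hα0 fun l hl => ?_).trans h3⟩
  refine tendsto_nhds_unique (hv' l) (tendsto_const_nhds.congr fun m => (hv _ l hl).symm)

end Compactness

/-! ### Weak compactness and convexity in L² -/

section SquareDistance

variable {N : ℕ}

lemma sqDist_eq {f g : Rn N → ℝ} (hf : MemLp f 2 (leb N)) (hg : MemLp g 2 (leb N)) :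
    sqDist f g = ENNReal.ofReal (‖hf.toLp f - hg.toLp g‖ ^ 2) := by
  rw [← MemLp.toLp_sub, Lp.norm_toLp, ENNReal.ofReal_pow ENNReal.toReal_nonneg,
    ENNReal.ofReal_toReal (hf.sub hg).2.ne]
  rfl

lemma sqDist_congr_left {f f' g : Rn N → ℝ} (h : f =ᵐ[leb N] f') : sqDist f g = sqDist f' g := by
  rw [sqDist, sqDist, eLpNorm_congr_ae]
  filter_upwards [h] with x hx
  rw [hx]

lemma memLp_of_sqDist_ne_top (u : L1 N ℝ) {g : Rn N → ℝ} (hg : MemLp g 2 (leb N))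
    (h : sqDist u g ≠ ⊤) : MemLp u 2 (leb N) := by
  have h1 : MemLp (fun x => u x - g x) 2 (leb N) := by
    refine ⟨(Lp.aestronglyMeasurable u).sub hg.1, ?_⟩
    rw [sqDist] at h
    exact lt_top_iff_ne_top.2 fun h' => h (by rw [h']; simp)
  have h2 := h1.add hg
  convert h2 using 1
  ext x
  simp

/-- The class in `L¹` of a square integrable function. -/
def ofL2 (f : Lp ℝ 2 (leb N)) : L1 N ℝ := ((Lp.memLp f).mono_exponent one_le_two).toLp f

lemma ofL2_ae_eq (f : Lp ℝ 2 (leb N)) : ofL2 f =ᵐ[leb N] f := MemLp.coeFn_toLp _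

lemma norm_ofL2_le : ∃ C : ℝ≥0, ∀ f : Lp ℝ 2 (leb N), ‖ofL2 f‖ ≤ C * ‖f‖ := by
  refine ⟨((leb N Set.univ) ^ (1 / (1 : ℝ≥0∞).toReal - 1 / (2 : ℝ≥0∞).toReal)).toNNReal,
    fun f => ?_⟩
  have h := eLpNorm_le_eLpNorm_mul_rpow_measure_univ one_le_two (Lp.aestronglyMeasurable f)
  have ht : leb N Set.univ ^ (1 / (1 : ℝ≥0∞).toReal - 1 / (2 : ℝ≥0∞).toReal) ≠ ⊤ :=
    ENNReal.rpow_ne_top_of_nonneg (by norm_num) (measure_ne_top _ _)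
  rw [ofL2, Lp.norm_toLp, Lp.norm_def]
  refine (ENNReal.toReal_mono (ENNReal.mul_ne_top (Lp.eLpNorm_ne_top f) ht) h).trans_eq ?_
  rw [ENNReal.toReal_mul, mul_comm]
  rfl

lemma toDistr_ofL2 (f : Lp ℝ 2 (leb N)) (φ : 𝓓(cube N, ℝ)) (hφ : MemLp φ 2 (leb N)) :
    toDistr (ofL2 f) φ = inner ℝ f (hφ.toLp φ) := by
  change ofFun _ _ = _
  rw [ofFun_apply, L2.inner_def]
  refine integral_congr_ae ?_
  filter_upwards [ofL2_ae_eq f, hφ.coeFn_toLp] with x h1 h2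
  rw [h1, h2]
  simp

lemma memLp_testFunction (φ : 𝓓(cube N, ℝ)) : MemLp φ 2 (leb N) :=
  MemLp.of_bound φ.continuous.aestronglyMeasurable ‖restrictTest φ‖
    (Eventually.of_forall (abs_testFunction_le φ))

/-- Bounded sequences in `L²` have weakly convergent subsequences. -/
lemma exists_subseq_weak_tendsto {f : ℕ → Lp ℝ 2 (leb N)} {R : ℝ} (hf : ∀ n, ‖f n‖ ≤ R) :
    ∃ (f' : Lp ℝ 2 (leb N)) (j : ℕ → ℕ), StrictMono j ∧
      ∀ h, Tendsto (fun n => inner ℝ (f (j n)) h) atTop (𝓝 (inner ℝ f' h)) := by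
  have : Fact ((2 : ℝ≥0∞) ≠ ⊤) := ⟨by simp⟩
  have : SeparableSpace (Lp ℝ 2 (leb N)) := inferInstance
  have hc := WeakDual.isSeqCompact_closedBall ℝ (Lp ℝ 2 (leb N)) 0 R
  obtain ⟨L, -, j, hj, hL⟩ := hc
    (x := fun n => StrongDual.toWeakDual (InnerProductSpace.toDual ℝ _ (f n))) fun n => by
      simpa using hf n
  refine ⟨(InnerProductSpace.toDual ℝ _).symm (WeakDual.toStrongDual L), j, hj, fun h => ?_⟩
  rw [InnerProductSpace.toDual_symm_apply]
  exact tendsto_iff_forall_eval_tendsto_topDualPairing.1 hL h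

/-- The square lies above its tangent: `2⟪f n - g, f' - g⟫ - ‖f' - g‖² ≤ ‖f n - g‖²`, and the left
side passes to the weak limit. -/
lemma norm_sub_le_of_weak_tendsto {f : ℕ → Lp ℝ 2 (leb N)} {f' g : Lp ℝ 2 (leb N)} {c : ℝ}
    (hf : ∀ h, Tendsto (fun n => inner ℝ (f n) h) atTop (𝓝 (inner ℝ f' h)))
    (hc : Tendsto (fun n => ‖f n - g‖ ^ 2) atTop (𝓝 c)) : ‖f' - g‖ ^ 2 ≤ c := by
  have h1 : Tendsto (fun n => 2 * inner ℝ (f n - g) (f' - g) - ‖f' - g‖ ^ 2) atTop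
      (𝓝 (2 * inner ℝ (f' - g) (f' - g) - ‖f' - g‖ ^ 2)) := by
    simp only [inner_sub_left]
    exact (((hf _).sub_const _).const_mul 2).sub_const _
  rw [real_inner_self_eq_norm_sq, two_mul, add_sub_cancel_right] at h1
  refine le_of_tendsto_of_tendsto' h1 hc fun n => ?_
  have h2 := real_inner_le_norm (f n - g) (f' - g)
  nlinarith [sq_nonneg (‖f n - g‖ - ‖f' - g‖)]

/-- Weak compactness and weak lower semicontinuity for the squared distance. -/
theorem exists_subseq_sqDist {uη : Rn N → ℝ} (hη : MemLp uη 2 (leb N)) {u : ℕ → L1 N ℝ} {C : ℝ≥0}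
    (hu : ∀ n, sqDist (u n) uη ≤ C) :
    ∃ (u' : L1 N ℝ) (j : ℕ → ℕ) (M : ℝ≥0), StrictMono j ∧ (∀ n, ‖u n‖ ≤ M) ∧
      (∀ φ, Tendsto (fun n => toDistr (u (j n)) φ) atTop (𝓝 (toDistr u' φ))) ∧
      ∀ (g : Rn N → ℝ) (i : ℕ → ℕ) (c : ℝ≥0∞), MemLp g 2 (leb N) → StrictMono i →
        Tendsto (fun n => sqDist (u (j (i n))) g) atTop (𝓝 c) → sqDist u' g ≤ c := by
  have hm : ∀ n, MemLp (u n) 2 (leb N) := fun n =>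
    memLp_of_sqDist_ne_top _ hη (ne_top_of_le_ne_top ENNReal.coe_ne_top (hu n))
  let f : ℕ → Lp ℝ 2 (leb N) := fun n => (hm n).toLp (u n)
  have hfu : ∀ n, ofL2 (f n) = u n := fun n =>
    Lp.ext ((ofL2_ae_eq (f n)).trans (MemLp.coeFn_toLp _))
  have hf : ∀ n, ‖f n‖ ≤ Real.sqrt C + ‖hη.toLp uη‖ := fun n => by
    have h1 := hu n
    rw [sqDist_eq (hm n) hη, ← ENNReal.ofReal_coe_nnreal] at h1
    replace h1 := (ENNReal.ofReal_le_ofReal_iff C.2).1 h1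
    calc ‖f n‖ = ‖(f n - hη.toLp uη) + hη.toLp uη‖ := by rw [sub_add_cancel]
      _ ≤ _ := (norm_add_le _ _).trans (add_le_add_left (Real.le_sqrt_of_sq_le h1) _)
  obtain ⟨f', j, hj, hw⟩ := exists_subseq_weak_tendsto hf
  obtain ⟨K, hK⟩ := norm_ofL2_le (N := N)
  refine ⟨ofL2 f', j, K * (Real.sqrt C + ‖hη.toLp uη‖).toNNReal, hj, fun n => ?_, fun φ => ?_,
    fun g i c hg hi hc => ?_⟩
  · rw [← hfu n]
    refine (hK _).trans ?_
    rw [NNReal.coe_mul, Real.coe_toNNReal _ (by positivity)]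
    exact mul_le_mul_of_nonneg_left (hf n) K.2
  · rw [toDistr_ofL2 _ _ (memLp_testFunction φ)]
    refine (hw _).congr fun n => ?_
    rw [← toDistr_ofL2, hfu]
  · by_cases hct : c = ⊤
    · rw [hct]; exact le_top
    have h1 : Tendsto (fun n => ‖f (j (i n)) - hg.toLp g‖ ^ 2) atTop (𝓝 c.toReal) := by
      refine ((ENNReal.tendsto_toReal hct).comp hc).congr fun n => ?_
      simp only [Function.comp_apply]
      rw [sqDist_eq (hm _) hg, ENNReal.toReal_ofReal (by positivity)]
    have h2 := norm_sub_le_of_weak_tendsto (fun h => (hw h).comp hi.tendsto_atTop) h1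
    rw [sqDist_congr_left (ofL2_ae_eq f'), sqDist_eq (Lp.memLp f') hg]
    refine ENNReal.ofReal_le_of_le_toReal ?_
    rwa [Lp.toLp_coeFn]

/-- The parallelogram law for `u - g` and `w - g`; the term with factor `1 / 4` is the gain from
strict convexity. -/
lemma sqDist_midpoint {u w : L1 N ℝ} {g : Rn N → ℝ} (hu : MemLp u 2 (leb N))
    (hw : MemLp w 2 (leb N)) (hg : MemLp g 2 (leb N)) :
    sqDist ((1 / 2 : ℝ) • (u + w) : L1 N ℝ) g + ENNReal.ofReal (1 / 4) * sqDist u w =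
      ENNReal.ofReal (1 / 2) * (sqDist u g + sqDist w g) := by
  have h : ((1 / 2 : ℝ) • (u + w) : L1 N ℝ) =ᵐ[leb N] (1 / 2 : ℝ) • ((u : Rn N → ℝ) + w) := by
    filter_upwards [Lp.coeFn_smul (1 / 2 : ℝ) (u + w), Lp.coeFn_add u w] with x h1 h2
    rw [h1, Pi.smul_apply, Pi.smul_apply, h2]
  rw [sqDist_congr_left h, sqDist_eq ((hu.add hw).const_smul _) hg, sqDist_eq hu hw,
    sqDist_eq hu hg, sqDist_eq hw hg, MemLp.toLp_const_smul _ (hu.add hw), MemLp.toLp_add hu hw,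
    ← ENNReal.ofReal_add (by positivity) (by positivity), ← ENNReal.ofReal_mul (by positivity),
    ← ENNReal.ofReal_mul (by positivity), ← ENNReal.ofReal_add (by positivity) (by positivity)]
  congr 1
  set a := hu.toLp u
  set b := hw.toLp w
  set c := hg.toLp g
  have e1 : (1 / 2 : ℝ) • (a + b) - c = (1 / 2 : ℝ) • ((a - c) + (b - c)) := by module
  have e2 : a - b = (a - c) - (b - c) := by abel
  have e3 := parallelogram_law_with_norm ℝ (a - c) (b - c)
  rw [e1, e2, norm_smul, mul_pow, Real.norm_eq_abs, abs_of_pos (by norm_num)]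
  linarith

lemma eq_of_sqDist_eq_zero {u w : L1 N ℝ} (h : sqDist u w = 0) : u = w := by
  rw [sqDist, sq_eq_zero_iff] at h
  replace h := (eLpNorm_eq_zero_iff
    ((Lp.aestronglyMeasurable u).sub (Lp.aestronglyMeasurable w)) two_ne_zero).1 h
  refine Lp.ext ?_
  filter_upwards [h] with x hx
  exact sub_eq_zero.1 hx

end SquareDistance

/-! ### Reconstructions and optimal parameters -/

section Reconstruction

variable {N k : ℕ} {S : Set (OpTuple N k)} {θ : ℝ} {uη : Rn N → ℝ}

/-- The functional of the Level 2 problem. -/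
def objective (uη : Rn N → ℝ) (p : (Fin (k + 1) → ℝ) × OpTuple N k) (u : L1 N ℝ) : ℝ≥0∞ :=
  sqDist u uη + pgv p.1 p.2 u

lemma pos_of_mem_params (hθ : 0 < θ) {p : (Fin (k + 1) → ℝ) × OpTuple N k} (hp : p ∈ params θ S)
    (i : Fin (k + 1)) : 0 < p.1 i := hθ.trans_le (hp.1 i).1

lemma isCompact_params (hS : IsTrainingSet S) : IsCompact (params θ S) := by
  have h : params θ S = (Set.pi Set.univ fun _ => Set.Icc θ (1 / θ)) ×ˢ S := by
    ext p
    simp only [params, Set.mem_prod, Set.mem_univ_pi]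
    rfl
  rw [h]
  exact (isCompact_univ_pi fun _ => isCompact_Icc).prod hS.isCompact

lemma zero_mem_BV : (0 : L1 N ℝ) ∈ BV N := by
  rw [mem_BV_iff, grad_zero, mass_zero]
  exact ENNReal.zero_ne_top

lemma sqDist_zero_ne_top (hη : MemLp uη 2 (leb N)) : sqDist (0 : L1 N ℝ) uη ≠ ⊤ := by
  rw [sqDist_congr_left (Lp.coeFn_zero ℝ 1 (leb N)), sqDist_eq MemLp.zero hη]
  exact ENNReal.ofReal_ne_top

lemma sqDist_comm (u w : Rn N → ℝ) : sqDist u w = sqDist w u := by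
  rw [sqDist, sqDist]
  exact congrArg (· ^ 2) (eLpNorm_sub_comm u w 2 (leb N))

lemma objective_zero {p : (Fin (k + 1) → ℝ) × OpTuple N k} (hα : ∀ i, 0 < p.1 i) :
    objective uη p 0 = sqDist (0 : L1 N ℝ) uη := by
  rw [objective, pgv_zero hα, add_zero]

lemma IsReconstruction.objective_le {p : (Fin (k + 1) → ℝ) × OpTuple N k} {u : L1 N ℝ}
    (h : IsReconstruction uη p.1 p.2 u) (hα : ∀ i, 0 < p.1 i) :
    objective uη p u ≤ sqDist (0 : L1 N ℝ) uη :=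
  (h.2 0 zero_mem_BV).trans_eq (objective_zero hα)

lemma IsReconstruction.memLp (hη : MemLp uη 2 (leb N)) {p : (Fin (k + 1) → ℝ) × OpTuple N k}
    {u : L1 N ℝ} (h : IsReconstruction uη p.1 p.2 u) (hα : ∀ i, 0 < p.1 i) :
    MemLp u 2 (leb N) :=
  memLp_of_sqDist_ne_top u hη (ne_top_of_le_ne_top (sqDist_zero_ne_top hη)
    ((le_add_right le_rfl).trans (h.objective_le hα)))

/-- Compactness and lower semicontinuity for the functionals of the Level 2 problems. -/
theorem exists_objective_le_of_tendsto (hS : IsTrainingSet S) (hθ : 0 < θ)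
    (hη : MemLp uη 2 (leb N)) {p : ℕ → (Fin (k + 1) → ℝ) × OpTuple N k}
    (hp : ∀ n, p n ∈ params θ S) {p' : (Fin (k + 1) → ℝ) × OpTuple N k}
    (hpp : Tendsto p atTop (𝓝 p')) {u : ℕ → L1 N ℝ} {C : ℝ≥0}
    (hC : ∀ n, objective uη (p n) (u n) ≤ C) {c : ℝ≥0∞}
    (hc : Tendsto (fun n => objective uη (p n) (u n)) atTop (𝓝 c)) :
    ∃ u' ∈ BV N, objective uη p' u' ≤ c ∧ ∀ (g : Rn N → ℝ) (d : ℝ≥0∞), MemLp g 2 (leb N) →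
      Tendsto (fun n => sqDist (u n) g) atTop (𝓝 d) → sqDist u' g ≤ d := by
  obtain ⟨u', j, M, hj, hM, hw, hsq⟩ :=
    exists_subseq_sqDist hη fun n => (le_add_right le_rfl).trans (hC n)
  -- Fidelity and seminorm need not converge separately; compactness of `[0, ∞]²` lets them along a
  -- subsequence, with limits that add up to `c`.
  obtain ⟨⟨a, b⟩, i, hi, hab⟩ := CompactSpace.tendsto_subseq
    fun n => (sqDist (u (j n)) uη, pgv (p (j n)).1 (p (j n)).2 (u (j n)))
  have ha : Tendsto (fun n => sqDist (u (j (i n))) uη) atTop (𝓝 a) :=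
    (continuous_fst.tendsto (a, b)).comp hab
  have hb : Tendsto (fun n => pgv (p (j (i n))).1 (p (j (i n))).2 (u (j (i n)))) atTop (𝓝 b) :=
    (continuous_snd.tendsto (a, b)).comp hab
  have hji : Tendsto (fun m => j (i m)) atTop atTop :=
    hj.tendsto_atTop.comp hi.tendsto_atTop
  have habc : a + b = c := tendsto_nhds_unique (ha.add hb) (hc.comp hji)
  have hpgv : ∀ n, pgv (p n).1 (p n).2 (u n) ≤ C := fun n => (le_add_left le_rfl).trans (hC n)
  -- A vanishing slack, at most one, for the strict inequality demanded by `pgv_le_of_tendsto`.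
  have hinv : Tendsto (fun n : ℕ => (((n + 1 : ℕ) : ℝ≥0∞))⁻¹) atTop (𝓝 0) :=
    ENNReal.tendsto_inv_nat_nhds_zero.comp (tendsto_add_atTop_nat 1)
  obtain ⟨hBV, hle⟩ := pgv_le_of_tendsto hS hθ (fun n => hp (j (i n))) (hpp.comp hji)
    (u := fun n => u (j (i n))) (C := M + (C + 1))
    (e := fun n => pgv (p (j (i n))).1 (p (j (i n))).2 (u (j (i n))) + (((n + 1 : ℕ) : ℝ≥0∞))⁻¹)
    (c := b) (fun n => (hM _).trans (by push_cast; linarith [C.2]))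
    (fun φ => (hw φ).comp hi.tendsto_atTop)
    (fun n => ENNReal.lt_add_right (ne_top_of_le_ne_top ENNReal.coe_ne_top (hpgv _)) (by simp))
    (fun n => by
      have h1 : (((n + 1 : ℕ) : ℝ≥0∞))⁻¹ ≤ 1 := ENNReal.inv_le_one.2 (by simp)
      push_cast at h1 ⊢
      exact le_add_left (add_le_add (hpgv _) h1))
    (by simpa using hb.add hinv)
  refine ⟨u', hBV, ?_, fun g d hg hd => hsq g id d hg strictMono_id (hd.comp hj.tendsto_atTop)⟩
  rw [← habc]
  exact add_le_add (hsq uη i a hη hi ha) hle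

/-- The Level 2 problem has a solution. -/
theorem exists_isReconstruction (hS : IsTrainingSet S) (hθ : 0 < θ) (hη : MemLp uη 2 (leb N))
    {p : (Fin (k + 1) → ℝ) × OpTuple N k} (hp : p ∈ params θ S) :
    ∃ u, IsReconstruction uη p.1 p.2 u := by
  have hα := pos_of_mem_params hθ hp
  -- Values above that of the zero function are discarded, so every member of the minimizing
  -- sequence satisfies one finite bound.
  have h0 : sqDist (0 : L1 N ℝ) uη ∈
      {c | c ∈ objective uη p '' BV N ∧ c ≤ sqDist (0 : L1 N ℝ) uη} :=
    ⟨⟨0, zero_mem_BV, objective_zero hα⟩, le_rfl⟩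
  obtain ⟨e, -, he, heS⟩ := exists_seq_tendsto_sInf ⟨_, h0⟩ (OrderBot.bddBelow _)
  choose u huBV hu using fun n => (heS n).1
  obtain ⟨u', hu', hle, -⟩ := exists_objective_le_of_tendsto hS hθ hη (fun _ => hp)
    tendsto_const_nhds (u := u) (C := (sqDist (0 : L1 N ℝ) uη).toNNReal)
    (fun n => by
      rw [ENNReal.coe_toNNReal (sqDist_zero_ne_top hη), hu]
      exact (heS n).2)
    (he.congr fun n => (hu n).symm)
  refine ⟨u', hu', fun w hw => ?_⟩
  change objective uη p u' ≤ objective uη p w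
  by_cases hwc : objective uη p w ≤ sqDist (0 : L1 N ℝ) uη
  · exact hle.trans (sInf_le ⟨⟨w, hw, rfl⟩, hwc⟩)
  · exact hle.trans ((sInf_le h0).trans (not_le.1 hwc).le)

/-- The Level 2 problem has at most one solution. -/
theorem IsReconstruction.unique (hη : MemLp uη 2 (leb N))
    {p : (Fin (k + 1) → ℝ) × OpTuple N k} (hα : ∀ i, 0 < p.1 i) {u w : L1 N ℝ}
    (hu : IsReconstruction uη p.1 p.2 u) (hw : IsReconstruction uη p.1 p.2 w) : u = w := by
  have hm : objective uη p u = objective uη p w := le_antisymm (hu.2 w hw.1) (hw.2 u hu.1)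
  have hfin : objective uη p u ≠ ⊤ :=
    ne_top_of_le_ne_top (sqDist_zero_ne_top hη) (hu.objective_le hα)
  have hhalf : ∀ x : ℝ≥0∞, ENNReal.ofReal (1 / 2) * (x + x) = x := fun x => by
    rw [← two_mul, ← mul_assoc, show (2 : ℝ≥0∞) = ENNReal.ofReal 2 by simp,
      ← ENNReal.ofReal_mul (by norm_num)]
    norm_num
  have hpgv : pgv p.1 p.2 ((1 / 2 : ℝ) • (u + w)) ≤
      ENNReal.ofReal (1 / 2) * (pgv p.1 p.2 u + pgv p.1 p.2 w) :=
    (pgv_smul_le hα (by norm_num)).trans (mul_le_mul_right (pgv_add_le hα) _)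
  have hBV : (1 / 2 : ℝ) • (u + w) ∈ BV N := by
    rw [mem_BV_iff, grad_smul, grad_add]
    refine ne_top_of_le_ne_top ?_ ((mass_smul_le _ _).trans (mul_le_mul_right (mass_add_le _ _) _))
    exact ENNReal.mul_ne_top ENNReal.ofReal_ne_top
      (ENNReal.add_ne_top.2 ⟨mem_BV_iff.1 hu.1, mem_BV_iff.1 hw.1⟩)
  have hmid := sqDist_midpoint (hu.memLp hη hα) (hw.memLp hη hα) hη
  -- The midpoint is a competitor and the seminorm is convex, so the strict convexity gain must
  -- vanish. Finiteness of the objective permits the cancellation.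
  have key : objective uη p u + ENNReal.ofReal (1 / 4) * sqDist u w ≤ objective uη p u + 0 :=
    calc objective uη p u + ENNReal.ofReal (1 / 4) * sqDist u w
        ≤ objective uη p ((1 / 2 : ℝ) • (u + w)) + ENNReal.ofReal (1 / 4) * sqDist u w :=
          add_le_add_left (hu.2 _ hBV) _
      _ = (sqDist ((1 / 2 : ℝ) • (u + w) : L1 N ℝ) uη + ENNReal.ofReal (1 / 4) * sqDist u w) +
          pgv p.1 p.2 ((1 / 2 : ℝ) • (u + w)) := by rw [objective, add_right_comm]
      _ ≤ ENNReal.ofReal (1 / 2) * (sqDist u uη + sqDist w uη) +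
          ENNReal.ofReal (1 / 2) * (pgv p.1 p.2 u + pgv p.1 p.2 w) :=
          add_le_add hmid.le hpgv
      _ = ENNReal.ofReal (1 / 2) * (objective uη p u + objective uη p w) := by
          rw [← mul_add, add_add_add_comm]
          rfl
      _ = objective uη p u + 0 := by rw [← hm, hhalf, add_zero]
  have h0 := (ENNReal.add_le_add_iff_left hfin).1 key
  rw [nonpos_iff_eq_zero, mul_eq_zero] at h0
  refine eq_of_sqDist_eq_zero (h0.resolve_left ?_)
  norm_num

/-- A limit of reconstructions is a reconstruction. -/
theorem IsReconstruction.sqDist_le_of_tendsto (hS : IsTrainingSet S) (hθ : 0 < θ)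
    (hη : MemLp uη 2 (leb N)) {p : ℕ → (Fin (k + 1) → ℝ) × OpTuple N k}
    (hp : ∀ n, p n ∈ params θ S) {p' : (Fin (k + 1) → ℝ) × OpTuple N k} (hp' : p' ∈ params θ S)
    (hpp : Tendsto p atTop (𝓝 p')) {u : ℕ → L1 N ℝ}
    (hu : ∀ n, IsReconstruction uη (p n).1 (p n).2 (u n)) {w : L1 N ℝ}
    (hw : IsReconstruction uη p'.1 p'.2 w) {g : Rn N → ℝ} (hg : MemLp g 2 (leb N)) {d : ℝ≥0∞}
    (hd : Tendsto (fun n => sqDist (u n) g) atTop (𝓝 d)) : sqDist w g ≤ d := by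
  have hα := fun n => pos_of_mem_params hθ (hp n)
  have hα' := pos_of_mem_params hθ hp'
  obtain ⟨c, i, hi, hc⟩ := CompactSpace.tendsto_subseq fun n => objective uη (p n) (u n)
  have hpi : Tendsto (fun n => p (i n)) atTop (𝓝 p') := hpp.comp hi.tendsto_atTop
  obtain ⟨u', hu', hle, hsq⟩ := exists_objective_le_of_tendsto hS hθ hη (fun n => hp (i n)) hpi
    (u := fun n => u (i n)) (C := (sqDist (0 : L1 N ℝ) uη).toNNReal)
    (fun n => by
      rw [ENNReal.coe_toNNReal (sqDist_zero_ne_top hη)]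
      exact (hu _).objective_le (hα _)) hc
  -- The fixed function `w` competes in every problem of the sequence, and upper semicontinuity in
  -- the parameters controls its cost there.
  have hcw : c ≤ objective uη p' w := by
    refine ENNReal.le_of_forall_pos_le_add fun ε hε _ => ?_
    have hlt : pgv p'.1 p'.2 w < pgv p'.1 p'.2 w + ε :=
      ENNReal.lt_add_right (pgv_ne_top hα' hw.1) (by simpa using hε.ne')
    have hev := eventually_pgv_lt ((continuous_fst.tendsto p').comp hpi)
      ((continuous_snd.tendsto p').comp hpi) hα' (fun n => hα (i n)) hlt
    refine le_of_tendsto hc ?_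
    filter_upwards [hev] with n hn
    refine ((hu (i n)).2 w hw.1).trans ?_
    rw [objective, add_assoc]
    exact add_le_add_right hn.le _
  have hrec : IsReconstruction uη p'.1 p'.2 u' :=
    ⟨hu', fun z hz => (hle.trans hcw).trans (hw.2 z hz)⟩
  -- Uniqueness identifies the weak limit with the given reconstruction.
  rw [← hrec.unique hη hα' hw]
  exact hsq g d hg (hd.comp hi.tendsto_atTop)

/-- The training scheme has a solution. -/
theorem exists_optimal_params (hS : IsTrainingSet S) (hθ : θ ∈ Set.Ioo (0 : ℝ) 1)
    (hη : MemLp uη 2 (leb N)) (hne : S.Nonempty) (uc : L1 N ℝ) :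
    ∃ p' ∈ params θ S, ∃ u' ∈ BV N, IsReconstruction uη p'.1 p'.2 u' ∧
      ∀ p ∈ params θ S, ∀ u : L1 N ℝ, IsReconstruction uη p.1 p.2 u →
        sqDist uc u' ≤ sqDist uc u := by
  have hparams : (params θ S).Nonempty := by
    obtain ⟨B, hB⟩ := hne
    refine ⟨(fun _ => 1, B), fun _ => ⟨hθ.2.le, ?_⟩, hB⟩
    rw [le_div_iff₀ hθ.1, one_mul]
    exact hθ.2.le
  by_cases huc : MemLp uc 2 (leb N)
  · choose! U hU using fun p (hp : p ∈ params θ S) => exists_isReconstruction hS hθ.1 hη hp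
    obtain ⟨e, -, he, heS⟩ := exists_seq_tendsto_sInf
      (hparams.image fun p => sqDist (U p) uc) (OrderBot.bddBelow _)
    choose p hp hpe using heS
    obtain ⟨p', hp', i, hi, hpi⟩ := (isCompact_params hS).tendsto_subseq hp
    refine ⟨p', hp', U p', (hU p' hp').1, hU p' hp', fun q hq u hu => ?_⟩
    rw [hu.unique hη (pos_of_mem_params hθ.1 hq) (hU q hq), sqDist_comm, sqDist_comm uc]
    have hle : sInf ((fun p => sqDist (U p) uc) '' params θ S) ≤ sqDist (U q) uc :=
      sInf_le ⟨q, hq, rfl⟩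
    refine le_trans ?_ hle
    exact IsReconstruction.sqDist_le_of_tendsto hS hθ.1 hη (fun n => hp (i n)) hp' hpi
      (fun n => hU _ (hp (i n))) (hU p' hp') huc
      ((he.congr fun n => (hpe n).symm).comp hi.tendsto_atTop)
  -- Every reconstruction is in L² because the fidelity is finite, so for `uc` outside L² all
  -- distances are `⊤`.
  · obtain ⟨p', hp'⟩ := hparams
    obtain ⟨u', hu'⟩ := exists_isReconstruction hS hθ.1 hη hp'
    refine ⟨p', hp', u', hu'.1, hu', fun q hq u hu => ?_⟩
    have : sqDist uc u = ⊤ := by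
      by_contra h
      exact huc (memLp_of_sqDist_ne_top uc (hu.memLp hη (pos_of_mem_params hθ.1 hq)) h)
    rw [this]
    exact le_top

end Reconstruction

end

end PGV

theorem theorem5p2 (N k : ℕ) (hN : 1 ≤ N) (hk : 1 ≤ k)
    (uη : PGV.Rn N → ℝ) (huη : MemLp uη 2 (PGV.leb N))
    (uc : PGV.L1 N ℝ) (huc : uc ∈ PGV.BV N)
    (θ : ℝ) (hθ : θ ∈ Set.Ioo (0 : ℝ) 1)
    (S : Set (PGV.OpTuple N k)) (hS : PGV.IsTrainingSet S) (hne : S.Nonempty) :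
    (∀ p ∈ PGV.params θ S, ∃! u : PGV.L1 N ℝ, PGV.IsReconstruction uη p.1 p.2 u) ∧
    ∃ p' ∈ PGV.params θ S, ∃ u' ∈ PGV.BV N, PGV.IsReconstruction uη p'.1 p'.2 u' ∧
      ∀ p ∈ PGV.params θ S, ∀ u : PGV.L1 N ℝ, PGV.IsReconstruction uη p.1 p.2 u →
        PGV.sqDist uc u' ≤ PGV.sqDist uc u := by
  refine ⟨fun p hp => ?_, PGV.exists_optimal_params hS hθ huη hne uc⟩
  obtain ⟨u, hu⟩ := PGV.exists_isReconstruction hS hθ.1 huη hp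
  exact ⟨u, hu, fun w hw => PGV.IsReconstruction.unique huη (PGV.pos_of_mem_params hθ.1 hp) hw hu⟩
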